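/- Let $n\ge 1$, $[n]=\{1,\dots,n\}$, and for integers $a,b$ let $[a;b]=\{s\in\mathbb Z: a\le s\le b\}$ (empty if $b<a$). For $i\ne j$ in $[n]$ and $s\in\mathbb Z$ let $H_{i,j,s}=\{x\in\mathbb R^n: x_i-x_j=s\}$. For a tuple $\mathbf S=(S_{i,j})_{1\le i<j\le n}$ of finite sets of integers let $\mathcal A_{\mathbf S}=\{H_{i,j,s}: i<j,\ s\in S_{i,j}\}$, and let $R(\mathcal A_{\mathbf S})$ be the set of its regions (connected components of the complement of the union of the hyperplanes). For $i<j$ put $S^+_{i,j}=\{s>0: H_{i,j,s}\in\mathcal A_{\mathbf S}\}$ and $S^+_{j,i}=\{s\ge 0: H_{j,i,s}\in\mathcal A_{\mathbf S}\}$; put $S^+_{i,i}=\emptyset$. Let $m=\max\bigcup_{i,j}S^+_{i,j}$, with $m=0$ if this union is empty. **$(\mathbf m,\varepsilon)$-arrangements.** $\mathcal A_{\mathbf S}$ is an $(\mathbf m,\varepsilon)$-arrangement if there are non-negative integers $m_1,\dots,m_n$ and $\varepsilon_{i,j}\in\{0,1\}$ ($i\neq j$), with $\varepsilon_{i,k}\le\varepsilon_{j,k}$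 whenever $i<j$ and $k\ne i,j$, such that $S^+_{i,j}=[1;m_j-\varepsilon_{i,j}]$ for $i<j$ and $S^+_{i,j}=[0;m_j-\varepsilon_{i,j}]$ for $i>j$. **Parking functions.** $D_{\mathbf S}$ is the directed multigraph on $[n+1]$ with $|S^+_{i,j}|$ arcs $(i,j)$ and one arc $(i,n+1)$ for all $i,j\in[n]$. $\mathrm{Park}_{\mathbf S}$ is the set of $D_{\mathbf S}$-parking functions: tuples $p\in\mathbb Z_{\ge0}^n$ such that every non-empty $U\subseteq[n]$ contains some $u$ for which $p_u$ is less than the number of arcs from $u$ to vertices outside $U$. **Labeling.** Let $R_0$ be the region of $\mathcal A_{\mathbf S}$ containing $\{x: x_1>x_2>\dots>x_n>x_1-1\}$. The generalized Pak–Stanley labeling sends a region $R$ to $\lambda(R)=(p_1,\dots,p_n)$ with $p_i=|\{(j,s): j\in[n],\ s\in S^+_{i,j},\ H_{i,j,s}\text{ separates }R\text{ from }R_0\}|$. **Sketches.** An $(m,n)$-sketch is a word $w$ of length $(m+1)n$ containing each letter $\alpha_i^s$ ($i\in[n]$, $s\in[0;m]$) exactly once, such that for all $i,j\in[n]$ and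 $s,t\in[1;m]$, $\alpha_i^{s-1}$ appears before $\alpha_i^s$, and if $\alpha_i^{s-1}$ appears before $\alpha_j^{t-1}$ then $\alpha_i^s$ appears before $\alpha_j^t$. Let $\beta(w)$ be the set of the points $x$ on no hyperplane of the $m$-Catalan arrangement (the arrangement with all $S_{i,j}=[-m;m]$) such that, for all $i,j\in[n]$ and $s\in[0;m]$, $x_i-x_j<s$ if and only if $\alpha_i^0$ is before $\alpha_j^s$ in $w$; it is a region of the $m$-Catalan arrangement. Let $\beta_{\mathbf S}(w)$ be the region of $\mathcal A_{\mathbf S}$ containing $\beta(w)$. **The map $\Psi$.** For $p\in\mathrm{Park}_{\mathbf S}$ the word $\Psi(p)$ is written letter by letter, maintaining a tuple $P\in\mathbb Z^n$, initially $P=p$, and a list $O$ of indices, initially empty. (1) If $P$ has a zero entry, let $k$ be the position of the rightmost one and $s=0$. (2) Otherwise, if $O$ is non-empty, remove its first element $k$ from $O$ and let $s=-P_k$. (3) Otherwise stop. In cases (1) and (2) write the letter $\alpha_k^s$, then subtract $1$ from $P_k$ and from every positive entry $P_i$ with $s\in S^+_{i,k}$, append $k$ at the end of $O$ if $s<m$,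 and repeat. **Theorem.** For every $(\mathbf m,\varepsilon)$-arrangement $\mathcal A_{\mathbf S}$, the map $\lambda$ is a bijection from $R(\mathcal A_{\mathbf S})$ to $\mathrm{Park}_{\mathbf S}$. For every $p\in\mathrm{Park}_{\mathbf S}$ the word $\Psi(p)$ is an $(m,n)$-sketch, $\beta(\Psi(p))$ is a region of the $m$-Catalan arrangement, and $\beta_{\mathbf S}\circ\Psi:\mathrm{Park}_{\mathbf S}\to R(\mathcal A_{\mathbf S})$ is the inverse of $\lambda$. Moreover, for every integer $k\ge0$, the $k$-Shi arrangement (all $S_{i,j}=[-k+1;k]$) is an $(\mathbf m,\varepsilon)$-arrangement, with $m_j=k$, $\varepsilon_{i,j}=0$ for $i<j$ and $\varepsilon_{i,j}=1$ for $i>j$, and the $k$-Catalan arrangement (all $S_{i,j}=[-k;k]$) is one, with $m_j=k$ and $\varepsilon_{i,j}=0$. -/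

import Mathlib

namespace GPS

/-- The affine hyperplane `x_i - x_j = s` in `ℝⁿ`. -/
def hyperplane {n : ℕ} (i j : Fin n) (s : ℤ) : Set (Fin n → ℝ) :=
  {x | x i - x j = (s : ℝ)}

/-- The `S`-braid arrangement, as a set of hyperplanes. Only the entries `S i j` with
`i < j` are used. -/
def braidArr {n : ℕ} (S : Fin n → Fin n → Finset ℤ) : Set (Set (Fin n → ℝ)) :=
  {H | ∃ i j : Fin n, ∃ s : ℤ, i < j ∧ s ∈ S i j ∧ H = hyperplane i j s}

/-- The complement of the union of the hyperplanes. -/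
def compl {n : ℕ} (A : Set (Set (Fin n → ℝ))) : Set (Fin n → ℝ) :=
  (⋃₀ A)ᶜ

/-- The regions of an arrangement: the connected components of its complement. -/
def regions {n : ℕ} (A : Set (Set (Fin n → ℝ))) : Set (Set (Fin n → ℝ)) :=
  {R | ∃ x ∈ compl A, R = connectedComponentIn (compl A) x}

/-- The region of `A` containing the set `X`. (For nonempty `X` there is at most one such
region, see `regionContaining_eq`; the value is empty if there is none.) -/
def regionContaining {n : ℕ} (A : Set (Set (Fin n → ℝ))) (X : Set (Fin n → ℝ)) :
    Set (Fin n → ℝ) :=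
  ⋃₀ {R | R ∈ regions A ∧ X ⊆ R}

theorem regionContaining_eq {n : ℕ} {A : Set (Set (Fin n → ℝ))} {X R : Set (Fin n → ℝ)}
    (hX : X.Nonempty) (hR : R ∈ regions A) (hXR : X ⊆ R) : regionContaining A X = R := by
  obtain ⟨y, hy⟩ := hX
  have key : ∀ T ∈ regions A, X ⊆ T → T = connectedComponentIn (compl A) y := by
    rintro T ⟨x, -, rfl⟩ hT
    exact connectedComponentIn_eq (hT hy)
  apply Set.Subset.antisymm
  · rintro z ⟨T, ⟨hT, hXT⟩, hz⟩
    rw [key R hR hXR, ← key T hT hXT]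
    exact hz
  · exact fun z hz => ⟨R, ⟨hR, hXR⟩, hz⟩

/-- The finite set `S⁺_{i,j}`: the `s > 0` (if `i < j`), respectively `s ≥ 0` (if `i > j`),
such that the hyperplane `x_i - x_j = s` is in the `S`-braid arrangement
(see `mem_Splus_iff`). It is empty for `i = j`. -/
def Splus {n : ℕ} (S : Fin n → Fin n → Finset ℤ) (i j : Fin n) : Finset ℤ :=
  if i < j then (S i j).filter (fun s => 0 < s)
  else if j < i then ((S j i).image (fun s => -s)).filter (fun s => 0 ≤ s)
  else ∅

theorem hyperplane_eq_of {n : ℕ} {i j k l : Fin n} {s t : ℤ} (hkl : k ≠ l)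
    (h : hyperplane i j s = hyperplane k l t) (hij : i ≠ j) :
    (i = k ∧ j = l ∧ s = t) ∨ (i = l ∧ j = k ∧ s = -t) := by
  have mem : ∀ x : Fin n → ℝ, x i - x j = (s : ℝ) ↔ x k - x l = (t : ℝ) := fun x =>
    Set.ext_iff.mp h x
  -- test points: a base point of the hyperplane, shifted in one coordinate
  have shift : ∀ (a : Fin n), a ≠ i → a ≠ j → a ≠ k ∧ a ≠ l := by
    intro a hai haj
    have h0 := (mem (fun b => if b = i then (s : ℝ) else 0)).mp (by simp [hij.symm])
    have h1 := (mem (fun b => if b = i then (s : ℝ) else if b = a then 1 else 0)).mp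
      (by simp [hij.symm, haj.symm])
    constructor
    · rintro rfl
      have hla := hkl.symm
      by_cases hli : l = i <;> simp_all <;> linarith
    · rintro rfl
      by_cases hki : k = i <;> simp_all <;> linarith
  have hk : k = i ∨ k = j := by
    by_contra hc
    push Not at hc
    exact (shift k hc.1 hc.2).1 rfl
  have hl : l = i ∨ l = j := by
    by_contra hc
    push Not at hc
    exact (shift l hc.1 hc.2).2 rfl
  have h0 := (mem (fun b => if b = i then (s : ℝ) else 0)).mp (by simp [hij.symm])
  rcases hk with rfl | rfl <;> rcases hl with rfl | rfl
  · exact absurd rfl hkl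
  · left
    refine ⟨rfl, rfl, ?_⟩
    simp [hij.symm] at h0
    exact_mod_cast h0
  · right
    refine ⟨rfl, rfl, ?_⟩
    simp [hij.symm] at h0
    have h2 : (s : ℝ) = ((-t : ℤ) : ℝ) := by push_cast; linarith
    exact_mod_cast h2
  · exact absurd rfl hkl

theorem mem_Splus_iff {n : ℕ} (S : Fin n → Fin n → Finset ℤ) (i j : Fin n) (s : ℤ) :
    s ∈ Splus S i j ↔
      (i < j ∧ 0 < s ∨ j < i ∧ 0 ≤ s) ∧ hyperplane i j s ∈ braidArr S := by
  have flip : hyperplane i j s = hyperplane j i (-s) := by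
    ext x
    simp only [hyperplane, Set.mem_ofPred_eq, Int.cast_neg]
    constructor <;> intro h <;> linarith
  have hmem : ∀ a b : Fin n, ∀ t : ℤ, a < b →
      (hyperplane a b t ∈ braidArr S ↔ t ∈ S a b) := by
    intro a b t hab
    constructor
    · rintro ⟨c, d, u, hcd, hu, he⟩
      rcases hyperplane_eq_of hcd.ne he hab.ne with ⟨rfl, rfl, rfl⟩ | ⟨rfl, rfl, -⟩
      · exact hu
      · exact absurd hab (lt_asymm hcd)
    · exact fun ht => ⟨a, b, t, hab, ht, rfl⟩
  rcases lt_trichotomy i j with h | h | h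
  · rw [hmem i j s h]
    simp [Splus, h, h.not_gt, and_comm]
  · subst h
    simp [Splus]
  · rw [flip, hmem j i (-s) h]
    simp only [Splus, h, h.not_gt, if_true, if_false, Finset.mem_filter, Finset.mem_image,
      false_and, true_and, false_or]
    constructor
    · rintro ⟨⟨a, ha, rfl⟩, h0⟩
      exact ⟨h0, by simpa using ha⟩
    · rintro ⟨h0, ha⟩
      exact ⟨⟨-s, ha, by simp⟩, h0⟩

/-- The `S`-braid arrangement is the arrangement with parameters `m` and `ε`; integer
intervals `[a; b]` with `b < a` are empty, and the diagonal entries of `ε` are irrelevant. -/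
def IsMEps {n : ℕ} (S : Fin n → Fin n → Finset ℤ) (m : Fin n → ℕ)
    (ε : Fin n → Fin n → ℕ) : Prop :=
  (∀ i j, i ≠ j → ε i j = 0 ∨ ε i j = 1) ∧
  (∀ i j k, i ≠ k → j ≠ k → i < j → ε i k ≤ ε j k) ∧
  (∀ i j, i < j → Splus S i j = Finset.Icc 1 ((m j : ℤ) - (ε i j : ℤ))) ∧
  (∀ i j, j < i → Splus S i j = Finset.Icc 0 ((m j : ℤ) - (ε i j : ℤ)))

/-- The tuple of the `m`-Shi arrangement. -/
noncomputable def shiTuple (n m : ℕ) : Fin n → Fin n → Finset ℤ :=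
  fun _ _ => Finset.Icc (-(m : ℤ) + 1) m

/-- The tuple of the `m`-Catalan arrangement. -/
noncomputable def catalanTuple (n m : ℕ) : Fin n → Fin n → Finset ℤ :=
  fun _ _ => Finset.Icc (-(m : ℤ)) m

/-- A directed multigraph on `V`: `D u v` is the number of arcs from `u` to `v`. -/
abbrev DiMultigraph (V : Type) : Type := V → V → ℕ

/-- The directed multigraph `D_S`: `|S⁺_{i,j}|` arcs from `i` to `j` and one arc from each `i`
to the additional last vertex. -/
def DS {n : ℕ} (S : Fin n → Fin n → Finset ℤ) : DiMultigraph (Fin (n + 1)) := fun u v =>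
  Fin.lastCases (motive := fun _ => ℕ) 0
    (fun i => Fin.lastCases (motive := fun _ => ℕ) 1 (fun j => (Splus S i j).card) v) u

/-- `D`-parking functions of length `n`: for every nonempty `U ⊆ [n]` some `u ∈ U` has `p u`
smaller than the number of arcs from `u` to vertices (in `[n + 1]`) outside `U`. -/
def IsParking {n : ℕ} (D : DiMultigraph (Fin (n + 1))) (p : Fin n → ℕ) : Prop :=
  ∀ U : Finset (Fin n), U.Nonempty →
    ∃ u ∈ U, p u < ∑ v ∈ (U.map Fin.castSuccEmb)ᶜ, D u.castSucc v

/-- The set of `D_S`-parking functions. -/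
def Park {n : ℕ} (S : Fin n → Fin n → Finset ℤ) : Set (Fin n → ℕ) :=
  {p | IsParking (DS S) p}

/-- The fundamental alcove `x_1 > x_2 > ⋯ > x_n > x_1 - 1`. -/
def alcove (n : ℕ) : Set (Fin n → ℝ) :=
  {x | (∀ i j, i < j → x j < x i) ∧ ∀ i j, x i - 1 < x j}

/-- The region `R₀` containing the fundamental alcove. -/
def baseRegion {n : ℕ} (S : Fin n → Fin n → Finset ℤ) : Set (Fin n → ℝ) :=
  regionContaining (braidArr S) (alcove n)

/-- The hyperplane `x_i - x_j = s` separates `R` from `R'`: they lie in opposite open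
half-spaces. -/
def Separates {n : ℕ} (i j : Fin n) (s : ℤ) (R R' : Set (Fin n → ℝ)) : Prop :=
  ((∀ x ∈ R, x i - x j < (s : ℝ)) ∧ (∀ y ∈ R', (s : ℝ) < y i - y j)) ∨
  ((∀ x ∈ R, (s : ℝ) < x i - x j) ∧ (∀ y ∈ R', y i - y j < (s : ℝ)))

/-- The generalized Pak–Stanley label of a region. -/
noncomputable def gps {n : ℕ} (S : Fin n → Fin n → Finset ℤ) (R : Set (Fin n → ℝ)) :
    Fin n → ℕ := fun i =>
  Set.ncard {q : Fin n × ℤ | q.2 ∈ Splus S i q.1 ∧ Separates i q.1 q.2 R (baseRegion S)}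

/-- The maximum of the union of the sets `S⁺_{i,j}` (and `0` if this union is empty). -/
def maxShift {n : ℕ} (S : Fin n → Fin n → Finset ℤ) : ℕ :=
  Finset.univ.sup fun i => Finset.univ.sup fun j => (Splus S i j).sup Int.toNat

/-- The pair `(i, s)` stands for the letter `α_i^s`. -/
abbrev Letter (n : ℕ) : Type := Fin n × ℕ

/-- The letter `a` appears before the letter `b` in the word `w`. -/
def Before {n : ℕ} (w : List (Letter n)) (a b : Letter n) : Prop :=
  ∃ r t : ℕ, r < t ∧ w[r]? = some a ∧ w[t]? = some b

/-- `(m, n)`-sketches. -/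
def IsSketch {n : ℕ} (m : ℕ) (w : List (Letter n)) : Prop :=
  w.length = (m + 1) * n ∧
  (∀ i s, (i, s) ∈ w ↔ s ≤ m) ∧
  (∀ i s, s < m → Before w (i, s) (i, s + 1)) ∧
  (∀ i j s t, s < m → t < m → Before w (i, s) (j, t) → Before w (i, s + 1) (j, t + 1))

/-- The region `β(w)` of the `m`-Catalan arrangement: the points `x` off the hyperplanes such
that `x_i - x_j < s` if and only if `α_i^0` is before `α_j^s` in `w`. -/
def beta {n : ℕ} (m : ℕ) (w : List (Letter n)) : Set (Fin n → ℝ) :=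
  {x | x ∈ compl (braidArr (catalanTuple n m)) ∧
    ∀ (i j : Fin n) (s : ℕ), s ≤ m → (x i - x j < (s : ℝ) ↔ Before w (i, 0) (j, s))}

/-- The region `β_S(w)` of the `S`-braid arrangement containing `β(w)`. -/
def betaS {n : ℕ} (S : Fin n → Fin n → Finset ℤ) (w : List (Letter n)) : Set (Fin n → ℝ) :=
  regionContaining (braidArr S) (beta (maxShift S) w)

/-- The set of zero entries of `P`. -/
def zeros {n : ℕ} (P : Fin n → ℤ) : Finset (Fin n) :=
  Finset.univ.filter fun i => P i = 0

/-- The update of the tuple when the letter `α_k^s` is written: subtract `1` from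
coordinate `k` and from every positive coordinate `i` with `s ∈ S⁺_{i,k}`. -/
def advance {n : ℕ} (S : Fin n → Fin n → Finset ℤ) (P : Fin n → ℤ) (k : Fin n) (s : ℤ) :
    Fin n → ℤ :=
  fun i => if i = k ∨ (0 < P i ∧ s ∈ Splus S i k) then P i - 1 else P i

/-- The list update when the letter `α_k^s` is written: append `k` if more letters of index
`k` are to follow. -/
def enqueue {n : ℕ} (m : ℕ) (O : List (Fin n)) (k : Fin n) (s : ℤ) : List (Fin n) :=
  if s < (m : ℤ) then O ++ [k] else O

/-- A quantity that decreases in each step of the process. -/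
def potential {n : ℕ} (m : ℕ) (P : Fin n → ℤ) (O : List (Fin n)) : ℕ :=
  2 * (∑ i, (P i + m + 1).toNat) + O.length

theorem advance_le {n : ℕ} (S : Fin n → Fin n → Finset ℤ) (P : Fin n → ℤ) (k : Fin n)
    (s : ℤ) (i : Fin n) : advance S P k s i ≤ P i := by
  unfold advance
  split_ifs <;> omega

theorem sum_advance_le {n : ℕ} (m : ℕ) (S : Fin n → Fin n → Finset ℤ) (P : Fin n → ℤ)
    (k : Fin n) (s : ℤ) :
    ∑ i, (advance S P k s i + m + 1).toNat ≤ ∑ i, (P i + m + 1).toNat :=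
  Finset.sum_le_sum fun i _ => by
    have := advance_le S P k s i
    omega

theorem sum_advance_lt {n : ℕ} (m : ℕ) (S : Fin n → Fin n → Finset ℤ) (P : Fin n → ℤ)
    (k : Fin n) (s : ℤ) (hk : -(m : ℤ) ≤ P k) :
    ∑ i, (advance S P k s i + m + 1).toNat < ∑ i, (P i + m + 1).toNat :=
  Finset.sum_lt_sum (fun i _ => by
    have := advance_le S P k s i
    omega) ⟨k, Finset.mem_univ k, by
      have : advance S P k s k = P k - 1 := by simp [advance]
      omega⟩

/-- The process that writes the word, started with the tuple `P` and the list `O`. If `P` has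
a zero entry, the next letter is `α_k^0` for the rightmost zero `k`; otherwise, if `O` is
nonempty, the next letter is `α_k^s` for the first element `k` of `O` and `s = -P k`, and `k` is
removed from the front of `O`; otherwise the process stops. After each letter `P` and `O` are
updated by `advance` and `enqueue`. -/
def psiRun {n : ℕ} (S : Fin n → Fin n → Finset ℤ) (m : ℕ) (P : Fin n → ℤ)
    (O : List (Fin n)) : List (Letter n) :=
  if h : (zeros P).Nonempty then
    ((zeros P).max' h, 0) ::
      psiRun S m (advance S P ((zeros P).max' h) 0) (enqueue m O ((zeros P).max' h) 0)
  else
    match O with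
    | [] => []
    | k :: O' =>
      (k, (-P k).toNat) :: psiRun S m (advance S P k (-P k)) (enqueue m O' k (-P k))
termination_by potential m P O
decreasing_by
  · have hz : P ((zeros P).max' h) = 0 := by
      have := (zeros P).max'_mem h
      simpa [zeros] using this
    have := sum_advance_lt m S P ((zeros P).max' h) 0 (by omega)
    have hl : (enqueue m O ((zeros P).max' h) 0).length ≤ O.length + 1 := by
      unfold enqueue
      split_ifs <;> simp
    unfold potential
    omega
  · unfold potential
    by_cases hs : -P k < (m : ℤ)
    · have := sum_advance_lt m S P k (-P k) (by omega)
      simp only [enqueue, hs, if_true, List.length_append, List.length_cons, List.length_nil]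
      omega
    · have := sum_advance_le m S P k (-P k)
      simp only [enqueue, hs, if_false, List.length_cons]
      omega

/-- The map `Ψ`: run the process from the tuple `p` and the empty list. -/
def Psi {n : ℕ} (S : Fin n → Fin n → Finset ℤ) (p : Fin n → ℕ) : List (Letter n) :=
  psiRun S (maxShift S) (fun i => (p i : ℤ)) []

end GPS

namespace GPS

/-! ### Words -/

section Words

variable {n : ℕ}

/-! Read the letter `α_j^s` as the number `x_j + s`. A region is a pattern of sides, that is, of
answers to the questions whether `x_j + s < x_i` for `s ∈ S⁺_{i,j}`. On the base region all answers
are negative, so the label of the region of `x` has as its `i`-th entry the number of letters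
`α_j^s` with `s ∈ S⁺_{i,j}` and `x_j + s < x_i` (`gps_sameSide`). It is parking: in `U`, take an
index with the least coordinate.

The map `Ψ` rebuilds the order of the letters from these numbers. While `α_i^0` is unwritten, `P_i`
counts the letters still owed before it. The list `O` is a first-in first-out queue: `α_k^{s+1}`
joins it when `α_k^s` is written, which is why the result is a sketch. These facts form `RunInv`.
The parking condition prevents the process from stopping with a positive entry. Every sketch is
realized by a point, so `Ψ(p)` defines a region, and the final counts say that its label is `p`
(`gps_betaS_Psi`). All this holds for every tuple `S`.

The `(m, ε)` condition is needed only for the other composition. Fix a point `x` of a region and run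
`Ψ` on its label. The word must never contradict `x`: when `α_k^s` is written, `x_k + s < x_i` for
every unwritten `α_i^0` with `s ∈ S⁺_{i,k}` (`lt_of_next`). If this fails for `i`, then `i` still
owes a letter `α_j^t` with `x_j + t < x_i < x_k + s`. The shape of the sets `S⁺` either makes `j <
i` a smaller failure, or lets the queue order reduce the comparison of `α_j^t` and `α_k^s` to one of
the arrangement's hyperplanes that the word has already decided in agreement with `x`. So the final
word determines the region of `x`. -/

/-- In this form precedence passes through `filter`, `map` and `++`, the operations in the queue
invariant. -/
theorem before_iff_sublist (w : List (Letter n)) (a b : Letter n) :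
    Before w a b ↔ List.Sublist [a, b] w := by
  constructor
  · rintro ⟨r, t, hrt, hr, ht⟩
    obtain ⟨hr', rfl⟩ := List.getElem?_eq_some_iff.1 hr
    obtain ⟨ht', rfl⟩ := List.getElem?_eq_some_iff.1 ht
    have h1 : List.Sublist [w[t]] (w.drop (r + 1)) := by
      rw [List.singleton_sublist, List.mem_iff_getElem]
      refine ⟨t - (r + 1), by simp; omega, ?_⟩
      simp only [List.getElem_drop]
      congr 1
      omega
    calc List.Sublist [w[r], w[t]] (w[r] :: w.drop (r + 1)) := h1.cons_cons _
      _ = w.drop r := List.getElem_cons_drop hr'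
      List.Sublist _ w := List.drop_sublist _ _
  · intro h
    induction w with
    | nil => simp at h
    | cons c w ih =>
      cases h with
      | cons _ h =>
        obtain ⟨r, t, hrt, hr, ht⟩ := ih h
        exact ⟨r + 1, t + 1, by omega, by simpa using hr, by simpa using ht⟩
      | cons_cons _ h =>
        obtain ⟨t, ht⟩ := List.mem_iff_getElem?.1 (List.singleton_sublist.1 h)
        exact ⟨0, t + 1, by omega, by simp, by simpa using ht⟩

theorem Before.mem_left {w : List (Letter n)} {a b : Letter n} (h : Before w a b) : a ∈ w := by
  obtain ⟨r, t, -, hr, -⟩ := h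
  exact List.mem_of_getElem? hr

theorem Before.mem_right {w : List (Letter n)} {a b : Letter n} (h : Before w a b) : b ∈ w := by
  obtain ⟨r, t, -, -, ht⟩ := h
  exact List.mem_of_getElem? ht

theorem before_iff_idxOf {w : List (Letter n)} (hw : w.Nodup) {a b : Letter n} :
    Before w a b ↔ a ∈ w ∧ b ∈ w ∧ w.idxOf a < w.idxOf b := by
  constructor
  · intro h
    refine ⟨h.mem_left, h.mem_right, ?_⟩
    obtain ⟨r, t, hrt, hr, ht⟩ := h
    obtain ⟨hr', rfl⟩ := List.getElem?_eq_some_iff.1 hr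
    obtain ⟨ht', rfl⟩ := List.getElem?_eq_some_iff.1 ht
    rwa [hw.idxOf_getElem, hw.idxOf_getElem]
  · rintro ⟨ha, hb, h⟩
    exact ⟨_, _, h, List.getElem?_idxOf ha, List.getElem?_idxOf hb⟩

theorem not_before_comm {w : List (Letter n)} (hw : w.Nodup) {a b : Letter n}
    (ha : a ∈ w) (hb : b ∈ w) (hab : a ≠ b) : ¬ Before w a b ↔ Before w b a := by
  have : w.idxOf a ≠ w.idxOf b := fun h => hab ((List.idxOf_inj ha).1 h)
  simp only [before_iff_idxOf hw, ha, hb, true_and]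
  omega

theorem not_before_self {w : List (Letter n)} (hw : w.Nodup) (a : Letter n) :
    ¬ Before w a a := by
  simp [before_iff_idxOf hw]

/-- The part of the word `w` before the letter `α_i^0`. -/
def upTo (i : Fin n) (w : List (Letter n)) : List (Letter n) :=
  w.takeWhile fun a => a ≠ (i, 0)

theorem mem_of_mem_upTo {i : Fin n} {w : List (Letter n)} {a : Letter n} (h : a ∈ upTo i w) :
    a ∈ w :=
  (List.takeWhile_sublist _).subset h

theorem upTo_of_notMem {i : Fin n} {w : List (Letter n)} (h : (i, 0) ∉ w) : upTo i w = w := by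
  rw [upTo, List.takeWhile_eq_self_iff]
  intro a ha
  simpa using fun h' : a = (i, 0) => h (h' ▸ ha)

theorem upTo_append_of_mem {i : Fin n} {w : List (Letter n)} (h : (i, 0) ∈ w)
    (v : List (Letter n)) : upTo i (w ++ v) = upTo i w := by
  rw [upTo, upTo, List.takeWhile_append, if_neg]
  intro hl
  have := (List.takeWhile_prefix (l := w) fun a => decide (a ≠ (i, 0))).eq_of_length hl
  rw [List.takeWhile_eq_self_iff] at this
  simpa using this _ h

theorem upTo_append_singleton_of_notMem {i k : Fin n} {s : ℕ} {w : List (Letter n)}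
    (h : (i, 0) ∉ w) (hik : i ≠ k) : upTo i (w ++ [(k, s)]) = w ++ [(k, s)] := by
  apply upTo_of_notMem
  simp [h, hik]

theorem upTo_append_self {i : Fin n} {w : List (Letter n)}
    (h : (i, 0) ∉ w) : upTo i (w ++ [(i, 0)]) = w := by
  have := upTo_of_notMem h
  rw [upTo] at this ⊢
  rw [List.takeWhile_append, this]
  simp

theorem mem_upTo_iff {i : Fin n} {w : List (Letter n)} (hw : w.Nodup) {a : Letter n} :
    a ∈ upTo i w ↔ a ∈ w ∧ a ≠ (i, 0) ∧ ¬ Before w (i, 0) a := by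
  simp only [before_iff_sublist]
  induction w with
  | nil => simp [upTo]
  | cons c w ih =>
    have ih := ih hw.of_cons
    have hc := (List.nodup_cons.1 hw).1
    by_cases hci : c = (i, 0)
    · subst hci
      simp only [upTo, ne_eq, decide_not, List.takeWhile_cons, decide_true, Bool.not_true,
        Bool.false_eq_true, ↓reduceIte, List.not_mem_nil, List.mem_cons, false_iff, not_and,
        not_not, List.cons_sublist_cons, List.singleton_sublist]
      tauto
    · have h1 : upTo i (c :: w) = c :: upTo i w := by simp [upTo, hci]
      have h2 : List.Sublist [(i, 0), a] (c :: w) ↔ List.Sublist [(i, 0), a] w := by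
        constructor
        · intro h
          cases h with
          | cons _ h => exact h
          | cons_cons _ h => exact absurd rfl hci
        · exact fun h => h.cons _
      rw [h1, h2, List.mem_cons, ih, List.mem_cons]
      by_cases hac : a = c
      · subst hac
        simp only [true_or, true_and, hci, ne_eq, not_false_eq_true, true_iff]
        intro h
        exact hc (h.subset (by simp))
      · simp [hac]

theorem mem_upTo_iff_before {i : Fin n} {w : List (Letter n)} (hw : w.Nodup) {a : Letter n}
    (hi : (i, 0) ∈ w) : a ∈ upTo i w ↔ Before w a (i, 0) := by
  rw [mem_upTo_iff hw]
  constructor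
  · rintro ⟨ha, hne, h⟩
    exact (not_before_comm hw hi ha hne.symm).1 h
  · intro h
    have hne : a ≠ (i, 0) := by
      rintro rfl
      exact not_before_self hw _ h
    exact ⟨h.mem_left, hne, (not_before_comm hw hi h.mem_left hne.symm).2 h⟩

theorem IsSketch.nodup {m : ℕ} {w : List (Letter n)} (hw : IsSketch m w) : w.Nodup := by
  have h : w.toFinset = Finset.univ ×ˢ Finset.range (m + 1) := by
    ext ⟨i, s⟩
    simp [hw.2.1]
  rw [← Multiset.coe_nodup, ← Multiset.toFinset_card_eq_card_iff_nodup]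
  change w.toFinset.card = w.length
  rw [h, hw.1]
  simp [mul_comm]

end Words

/-! ### Points realizing a sketch -/

section Realization

variable {n : ℕ}

/-- Distinct letters are comparable, so the shift axiom applied to the reversed pair gives its own
converse. -/
theorem IsSketch.before_pred {m : ℕ} {w : List (Letter n)} (hw : IsSketch m w) {i j : Fin n}
    (hij : i ≠ j) {s t : ℕ} (hs : s < m) (ht : t < m)
    (h : Before w (i, s + 1) (j, t + 1)) : Before w (i, s) (j, t) := by
  by_contra hc
  have hi : ∀ a ≤ m, ∀ l : Fin n, (l, a) ∈ w := fun a ha l => (hw.2.1 l a).2 ha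
  rw [not_before_comm hw.nodup (hi _ hs.le _) (hi _ ht.le _) (by simp [hij])] at hc
  have := hw.2.2.2 _ _ _ _ ht hs hc
  rw [← not_before_comm hw.nodup (hi _ hs _) (hi _ ht _) (by simp [hij])] at this
  exact this h

theorem IsSketch.before_of_lt {m : ℕ} {w : List (Letter n)} (hw : IsSketch m w) (i : Fin n)
    {s t : ℕ} (hst : s < t) (ht : t ≤ m) : Before w (i, s) (i, t) := by
  have hd := hw.nodup
  induction t, hst using Nat.le_induction with
  | base => exact hw.2.2.1 i s ht
  | succ t _ ih =>
    have h1 := ih (by omega)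
    have h2 := hw.2.2.1 i t (by omega)
    rw [before_iff_idxOf hd] at *
    exact ⟨h1.1, h2.2.1, h1.2.2.trans h2.2.2⟩

/-- Coordinates are chosen in the order in which the letters `α_k^0` occur; `N` bounds the positions
treated so far. -/
theorem IsSketch.exists_realization_aux {m : ℕ} {w : List (Letter n)} (hw : IsSketch m w)
    (N : ℕ) : ∃ x : Fin n → ℝ, ∀ i j : Fin n, w.idxOf (i, 0) < N → w.idxOf (j, 0) < N →
      ∀ s t : ℕ, Before w (i, s) (j, t) → x i + s < x j + t := by
  have hd := hw.nodup
  have hmem : ∀ (i : Fin n) (s : ℕ), s ≤ m → (i, s) ∈ w := fun i s => (hw.2.1 i s).2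
  induction N with
  | zero => exact ⟨0, by simp⟩
  | succ N ih =>
    obtain ⟨x, hx⟩ := ih
    by_cases hN : ∃ k : Fin n, w.idxOf (k, 0) = N
    swap
    · push Not at hN
      refine ⟨x, fun i j hi hj => hx i j ?_ ?_⟩
      · have := hN i; omega
      · have := hN j; omega
    obtain ⟨k, hk⟩ := hN
    have hlt : ∀ i, w.idxOf (i, 0) < N + 1 → i ≠ k → w.idxOf (i, 0) < N := by
      intro i hi hik
      have : w.idxOf (i, 0) ≠ w.idxOf (k, 0) := fun h =>
        hik (by simpa using (List.idxOf_inj (hmem i 0 (Nat.zero_le _))).1 h)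
      omega
    classical
    let T : Finset (Letter n) := w.toFinset.filter fun a => w.idxOf (a.1, 0) < N
    let lo := (T.filter fun a => Before w a (k, 0)).image fun a => x a.1 + a.2
    let up := (T.filter fun a => Before w (k, 0) a).image fun a => x a.1 + a.2
    -- By the induction hypothesis, the old letters before `α_k^0` have smaller values than those
    -- after it, so a value for `α_k^0` fits between.
    obtain ⟨z, hz1, hz2⟩ := Order.exists_between_finsets lo up (by
      intro u hu v hv
      simp only [lo, up, T, Finset.mem_image, Finset.mem_filter, List.mem_toFinset] at hu hv
      obtain ⟨⟨i, s⟩, ⟨⟨hi1, hi2⟩, hi3⟩, rfl⟩ := hu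
      obtain ⟨⟨j, t⟩, ⟨⟨hj1, hj2⟩, hj3⟩, rfl⟩ := hv
      refine hx i j hi2 hj2 s t ?_
      rw [before_iff_idxOf hd] at *
      exact ⟨hi1, hj1, hi3.2.2.trans hj3.2.2⟩)
    have hlo : ∀ i s, w.idxOf (i, 0) < N → Before w (i, s) (k, 0) → x i + s < z := by
      intro i s h h'
      refine hz1 _ (Finset.mem_image.2 ⟨(i, s), ?_, rfl⟩)
      simp only [T, Finset.mem_filter, List.mem_toFinset]
      exact ⟨⟨h'.mem_left, h⟩, h'⟩
    have hhi : ∀ i s, w.idxOf (i, 0) < N → Before w (k, 0) (i, s) → z < x i + s := by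
      intro i s h h'
      refine hz2 _ (Finset.mem_image.2 ⟨(i, s), ?_, rfl⟩)
      simp only [T, Finset.mem_filter, List.mem_toFinset]
      exact ⟨⟨h'.mem_right, h⟩, h'⟩
    have hzero : ∀ i, w.idxOf (i, 0) < N → Before w (i, 0) (k, 0) := by
      intro i hi
      rw [before_iff_idxOf hd]
      exact ⟨hmem _ _ (Nat.zero_le _), hmem _ _ (Nat.zero_le _), by omega⟩
    -- comparison of the new letters with the old ones
    have hlo' : ∀ i, i ≠ k → w.idxOf (i, 0) < N → ∀ t s, Before w (i, s) (k, t) →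
        x i + s < z + t := by
      intro i hik hi t
      induction t with
      | zero =>
        intro s h
        simpa using hlo i s hi h
      | succ t iht =>
        intro s h
        -- Lower both exponents until one is `0`. For `s = 0` the claim is clear, since `α_i^0`
        -- precedes `α_k^0`.
        rcases s with _ | s
        · have := hlo i 0 hi (hzero i hi)
          push_cast at *
          linarith [Nat.cast_nonneg (α := ℝ) t]
        · have h1 := (hw.2.1 _ _).1 h.mem_left
          have h2 := (hw.2.1 _ _).1 h.mem_right
          have := iht s (hw.before_pred hik h1 h2 h)
          push_cast
          linarith
    have hhi' : ∀ i, i ≠ k → w.idxOf (i, 0) < N → ∀ t s, Before w (k, t) (i, s) →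
        z + t < x i + s := by
      intro i hik hi t
      induction t with
      | zero =>
        intro s h
        simpa using hhi i s hi h
      | succ t iht =>
        intro s h
        rcases s with _ | s
        · have h1 := hzero i hi
          have h2 := hw.before_of_lt k (show 0 < t + 1 by omega) ((hw.2.1 _ _).1 h.mem_left)
          rw [before_iff_idxOf hd] at *
          omega
        · have h1 := (hw.2.1 _ _).1 h.mem_left
          have h2 := (hw.2.1 _ _).1 h.mem_right
          have := iht s (hw.before_pred hik.symm h1 h2 h)
          push_cast
          linarith
    refine ⟨Function.update x k z, fun i j hi hj s t h => ?_⟩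
    by_cases hik : i = k <;> by_cases hjk : j = k
    · subst hik hjk
      have hst : s < t := by
        by_contra hc
        rcases (not_lt.1 hc).lt_or_eq with h' | rfl
        · have := hw.before_of_lt j h' ((hw.2.1 _ _).1 h.mem_left)
          rw [before_iff_idxOf hd] at *
          omega
        · exact not_before_self hd _ h
      have : (s : ℝ) < t := by exact_mod_cast hst
      linarith
    · subst hik
      simpa [Function.update_of_ne hjk] using hhi' j hjk (hlt j hj hjk) s t h
    · subst hjk
      simpa [Function.update_of_ne hik] using hlo' i hik (hlt i hi hik) t s h
    · simpa [Function.update_of_ne hik, Function.update_of_ne hjk] using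
        hx i j (hlt i hi hik) (hlt j hj hjk) s t h

theorem IsSketch.exists_realization {m : ℕ} {w : List (Letter n)} (hw : IsSketch m w) :
    ∃ x : Fin n → ℝ, ∀ (i j : Fin n) (s t : ℕ), Before w (i, s) (j, t) →
      x i + s < x j + t := by
  obtain ⟨x, hx⟩ := hw.exists_realization_aux w.length
  refine ⟨x, fun i j => hx i j ?_ ?_⟩ <;>
  exact List.idxOf_lt_length_iff.2 ((hw.2.1 _ _).2 (Nat.zero_le _))

end Realization

/-! ### Regions of deformations of the braid arrangement -/

section Regions

variable {n : ℕ}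

theorem nonneg_of_mem_Splus {S : Fin n → Fin n → Finset ℤ} {i j : Fin n} {s : ℤ}
    (h : s ∈ Splus S i j) : 0 ≤ s := by
  rcases ((mem_Splus_iff S i j s).1 h).1 with h | h
  · exact h.2.le
  · exact h.2

theorem ne_of_mem_Splus {S : Fin n → Fin n → Finset ℤ} {i j : Fin n} {s : ℤ}
    (h : s ∈ Splus S i j) : i ≠ j := by
  rcases ((mem_Splus_iff S i j s).1 h).1 with h | h
  · exact h.1.ne
  · exact h.1.ne'

theorem pos_of_mem_Splus {S : Fin n → Fin n → Finset ℤ} {i j : Fin n} {s : ℤ}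
    (h : s ∈ Splus S i j) (hij : i < j) : 0 < s := by
  rcases ((mem_Splus_iff S i j s).1 h).1 with h | h
  · exact h.2
  · exact absurd hij h.1.asymm

theorem le_maxShift {S : Fin n → Fin n → Finset ℤ} {i j : Fin n} {s : ℤ}
    (h : s ∈ Splus S i j) : s ≤ maxShift S := by
  have h1 : s.toNat ≤ maxShift S :=
    (Finset.le_sup (f := Int.toNat) h).trans <|
      (Finset.le_sup (f := fun j => (Splus S i j).sup Int.toNat) (Finset.mem_univ j)).trans <|
      Finset.le_sup (f := fun i => Finset.univ.sup fun j => (Splus S i j).sup Int.toNat)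
        (Finset.mem_univ i)
  omega

theorem neg_mem_Splus {S : Fin n → Fin n → Finset ℤ} {i j : Fin n} {s : ℤ} (hij : i < j)
    (h : s ∈ S i j) (hs : s ≤ 0) : -s ∈ Splus S j i := by
  simpa [Splus, hij, hij.not_gt] using ⟨h, hs⟩

theorem pos_mem_Splus {S : Fin n → Fin n → Finset ℤ} {i j : Fin n} {s : ℤ} (hij : i < j)
    (h : s ∈ S i j) (hs : 0 < s) : s ∈ Splus S i j := by
  simpa [Splus, hij] using ⟨h, hs⟩

theorem mem_compl_braidArr_iff {S : Fin n → Fin n → Finset ℤ} {x : Fin n → ℝ} :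
    x ∈ compl (braidArr S) ↔ ∀ i j, ∀ s ∈ Splus S i j, x i - x j ≠ (s : ℝ) := by
  constructor
  · intro hx i j s hs h
    exact hx ⟨_, ((mem_Splus_iff S i j s).1 hs).2, h⟩
  · rintro h ⟨_, ⟨i, j, s, hij, hs, rfl⟩, hx⟩
    rcases le_or_gt s 0 with h0 | h0
    · refine h j i _ (neg_mem_Splus hij hs h0) ?_
      have : x i - x j = (s : ℝ) := hx
      push_cast
      linarith
    · exact h i j s (pos_mem_Splus hij hs h0) hx

/-- The points on the same side as `x` of all hyperplanes of the arrangement. -/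
def sameSide (S : Fin n → Fin n → Finset ℤ) (x : Fin n → ℝ) : Set (Fin n → ℝ) :=
  {y | y ∈ compl (braidArr S) ∧
    ∀ i j, ∀ s ∈ Splus S i j, ((s : ℝ) < y i - y j ↔ (s : ℝ) < x i - x j)}

theorem isPreconnected_sameSide (S : Fin n → Fin n → Finset ℤ) (x : Fin n → ℝ) :
    IsPreconnected (sameSide S x) := by
  apply Convex.isPreconnected
  rintro y ⟨hy, hyx⟩ z ⟨hz, hzx⟩ a b ha hb hab
  rw [mem_compl_braidArr_iff] at hy hz
  have key : ∀ i j, ∀ s ∈ Splus S i j,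
      ((s : ℝ) < x i - x j ∧ (s : ℝ) < (a • y + b • z) i - (a • y + b • z) j) ∨
      (¬ (s : ℝ) < x i - x j ∧ (a • y + b • z) i - (a • y + b • z) j < (s : ℝ)) := by
    intro i j s hs
    have e : (a • y + b • z) i - (a • y + b • z) j = a * (y i - y j) + b * (z i - z j) := by
      simp; ring
    have e' : (s : ℝ) = a * s + b * s := by rw [← add_mul, hab, one_mul]
    rw [e]
    by_cases h : (s : ℝ) < x i - x j
    · left
      refine ⟨h, ?_⟩
      have h1 := (hyx i j s hs).2 h
      have h2 := (hzx i j s hs).2 h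
      -- A zero weight would lose the strict inequality, so `a = 0` is treated apart.
      rcases ha.lt_or_eq with ha | rfl
      · nlinarith [mul_lt_mul_of_pos_left h1 ha, mul_le_mul_of_nonneg_left h2.le hb]
      · have : b = 1 := by linarith
        subst this
        linarith
    · right
      refine ⟨h, ?_⟩
      have h1 : y i - y j < s :=
        lt_of_le_of_ne (not_lt.1 fun h' => h ((hyx i j s hs).1 h')) (hy i j s hs)
      have h2 : z i - z j < s :=
        lt_of_le_of_ne (not_lt.1 fun h' => h ((hzx i j s hs).1 h')) (hz i j s hs)
      rcases ha.lt_or_eq with ha | rfl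
      · nlinarith [mul_lt_mul_of_pos_left h1 ha, mul_le_mul_of_nonneg_left h2.le hb]
      · have : b = 1 := by linarith
        subst this
        linarith
  refine ⟨mem_compl_braidArr_iff.2 fun i j s hs => ?_, fun i j s hs => ?_⟩
  · rcases key i j s hs with h | h
    · exact h.2.ne'
    · exact h.2.ne
  · rcases key i j s hs with h | h
    · exact iff_of_true h.2 h.1
    · exact iff_of_false h.2.asymm h.1

/-- A side pattern cuts out a convex set. Conversely, the image of a component under `x_i - x_j` is
an interval that misses `s`, so sides are constant on it. -/
theorem connectedComponentIn_compl_eq {S : Fin n → Fin n → Finset ℤ} {x : Fin n → ℝ}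
    (hx : x ∈ compl (braidArr S)) :
    connectedComponentIn (compl (braidArr S)) x = sameSide S x := by
  apply Set.Subset.antisymm
  · intro y hy
    have hsub := connectedComponentIn_subset (compl (braidArr S)) x
    refine ⟨hsub hy, fun i j s hs => ?_⟩
    have himg : IsPreconnected
        ((fun z : Fin n → ℝ => z i - z j) '' connectedComponentIn (compl (braidArr S)) x) :=
      isPreconnected_connectedComponentIn.image _ (by fun_prop)
    have hord := himg.ordConnected
    have hne : (s : ℝ) ∉
        (fun z : Fin n → ℝ => z i - z j) '' connectedComponentIn (compl (braidArr S)) x := by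
      rintro ⟨z, hz, hzs⟩
      exact mem_compl_braidArr_iff.1 (hsub hz) i j s hs hzs
    have h1 := Set.mem_image_of_mem (fun z : Fin n → ℝ => z i - z j) hy
    have h2 := Set.mem_image_of_mem (fun z : Fin n → ℝ => z i - z j)
      (mem_connectedComponentIn hx)
    constructor
    · intro h
      by_contra hc
      exact hne (hord.out h2 h1 ⟨not_lt.1 hc, h.le⟩)
    · intro h
      by_contra hc
      exact hne (hord.out h1 h2 ⟨not_lt.1 hc, h.le⟩)
  · exact (isPreconnected_sameSide S x).subset_connectedComponentIn
      ⟨hx, fun _ _ _ _ => Iff.rfl⟩ fun y hy => hy.1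

theorem sameSide_mem_regions {S : Fin n → Fin n → Finset ℤ} {x : Fin n → ℝ}
    (hx : x ∈ compl (braidArr S)) : sameSide S x ∈ regions (braidArr S) :=
  ⟨x, hx, (connectedComponentIn_compl_eq hx).symm⟩

theorem exists_eq_sameSide {S : Fin n → Fin n → Finset ℤ} {R : Set (Fin n → ℝ)}
    (hR : R ∈ regions (braidArr S)) : ∃ x ∈ compl (braidArr S), R = sameSide S x := by
  obtain ⟨x, hx, rfl⟩ := hR
  exact ⟨x, hx, connectedComponentIn_compl_eq hx⟩

theorem self_mem_sameSide {S : Fin n → Fin n → Finset ℤ} {x : Fin n → ℝ}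
    (hx : x ∈ compl (braidArr S)) : x ∈ sameSide S x :=
  ⟨hx, fun _ _ _ _ => Iff.rfl⟩

/-! ### The base region and the labels -/

theorem alcove_nonempty (n : ℕ) : (alcove n).Nonempty := by
  refine ⟨fun i => -(i : ℝ) / n, fun i j hij => ?_, fun i j => ?_⟩
  · have hn : (0 : ℝ) < n := by exact_mod_cast i.pos
    have : (i : ℝ) < j := by exact_mod_cast hij
    exact div_lt_div_of_pos_right (by linarith) hn
  · have hn : (0 : ℝ) < n := by exact_mod_cast i.pos
    have h1 : (j : ℝ) < n := by exact_mod_cast j.2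
    have h2 : (0 : ℝ) ≤ i := by positivity
    rw [sub_lt_iff_lt_add, div_add_one hn.ne']
    exact div_lt_div_of_pos_right (by linarith) hn

theorem lt_of_mem_alcove {S : Fin n → Fin n → Finset ℤ} {x : Fin n → ℝ} (hx : x ∈ alcove n)
    {i j : Fin n} {s : ℤ} (hs : s ∈ Splus S i j) : x i - x j < s := by
  rcases ((mem_Splus_iff S i j s).1 hs).1 with h | h
  · have h1 : (1 : ℝ) ≤ s := by exact_mod_cast h.2
    linarith [hx.2 i j]
  · have h1 : (0 : ℝ) ≤ s := by exact_mod_cast h.2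
    linarith [hx.1 j i h.1]

/-- On the alcove `x_i - x_j` is below `1`, and negative if `j < i`; these are the bounds built into
`S⁺`. Hence separation from the base region always means `s < x_i - x_j`. -/
theorem lt_of_mem_baseRegion {S : Fin n → Fin n → Finset ℤ} :
    (baseRegion S).Nonempty ∧
      ∀ x ∈ baseRegion S, ∀ i j, ∀ s ∈ Splus S i j, x i - x j < s := by
  obtain ⟨a, ha⟩ := alcove_nonempty n
  have hc : ∀ y ∈ alcove n, y ∈ compl (braidArr S) := fun y hy =>
    mem_compl_braidArr_iff.2 fun i j s hs => (lt_of_mem_alcove hy hs).ne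
  have e : baseRegion S = sameSide S a :=
    regionContaining_eq ⟨a, ha⟩ (sameSide_mem_regions (hc a ha)) fun y hy =>
      ⟨hc y hy, fun i j s hs =>
        iff_of_false (lt_of_mem_alcove hy hs).asymm (lt_of_mem_alcove ha hs).asymm⟩
  rw [e]
  refine ⟨⟨a, self_mem_sameSide (hc a ha)⟩, fun x hx i j s hs => ?_⟩
  refine lt_of_le_of_ne (not_lt.1 fun h => ?_) (mem_compl_braidArr_iff.1 hx.1 i j s hs)
  exact (lt_of_mem_alcove ha hs).asymm ((hx.2 i j s hs).1 h)

theorem separates_sameSide_iff {S : Fin n → Fin n → Finset ℤ} {x : Fin n → ℝ}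
    (hx : x ∈ compl (braidArr S)) {i j : Fin n} {s : ℤ} (hs : s ∈ Splus S i j) :
    Separates i j s (sameSide S x) (baseRegion S) ↔ (s : ℝ) < x i - x j := by
  obtain ⟨⟨a, ha⟩, hb⟩ := lt_of_mem_baseRegion (S := S)
  constructor
  · rintro (h | h)
    · exact absurd (h.2 a ha) (hb a ha i j s hs).asymm
    · exact h.1 x (self_mem_sameSide hx)
  · exact fun h => Or.inr ⟨fun y hy => (hy.2 i j s hs).2 h, fun y hy => hb y hy i j s hs⟩

/-- The letters `α_j^s` with `s ∈ S⁺_{i,j}` and `x_j + s < x_i`. -/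
noncomputable def crossed (S : Fin n → Fin n → Finset ℤ) (x : Fin n → ℝ) (i : Fin n) :
    Finset (Letter n) :=
  Finset.filter (fun a => (a.2 : ℤ) ∈ Splus S i a.1 ∧ x a.1 + a.2 < x i)
    (Finset.univ ×ˢ Finset.range (maxShift S + 1))

theorem mem_crossed {S : Fin n → Fin n → Finset ℤ} {x : Fin n → ℝ} {i : Fin n}
    {a : Letter n} :
    a ∈ crossed S x i ↔ (a.2 : ℤ) ∈ Splus S i a.1 ∧ x a.1 + a.2 < x i := by
  simp only [crossed, Finset.mem_filter, Finset.mem_product, Finset.mem_univ, true_and,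
    Finset.mem_range, and_iff_right_iff_imp]
  intro h
  have := le_maxShift h.1
  omega

theorem gps_sameSide {S : Fin n → Fin n → Finset ℤ} {x : Fin n → ℝ}
    (hx : x ∈ compl (braidArr S)) (i : Fin n) :
    gps S (sameSide S x) i = (crossed S x i).card := by
  have hinj : Function.Injective fun a : Letter n => (a.1, (a.2 : ℤ)) := by
    rintro ⟨j, s⟩ ⟨k, t⟩ h
    simpa using h
  rw [gps, ← Set.ncard_coe_finset, ← Set.ncard_image_of_injective _ hinj]
  congr 1
  ext ⟨j, s⟩
  simp only [Set.mem_ofPred_eq, Set.mem_image, Finset.mem_coe, mem_crossed]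
  constructor
  · rintro ⟨hs, h⟩
    have h := (separates_sameSide_iff hx hs).1 h
    lift s to ℕ using nonneg_of_mem_Splus hs
    refine ⟨(j, s), ⟨hs, ?_⟩, rfl⟩
    push_cast at h
    simp only
    linarith
  · rintro ⟨⟨k, t⟩, ⟨hs, h⟩, he⟩
    obtain ⟨rfl, rfl⟩ := Prod.mk.inj he
    refine ⟨hs, (separates_sameSide_iff hx hs).2 ?_⟩
    push_cast
    simp only at h
    linarith

/-! ### Parking functions -/

/-- The summand `1` is the arc to the extra vertex; it turns the strict parking inequality into `≤`.
-/
theorem sum_DS_eq (S : Fin n → Fin n → Finset ℤ) (u : Fin n) (U : Finset (Fin n)) :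
    ∑ v ∈ (U.map Fin.castSuccEmb)ᶜ, DS S u.castSucc v =
      (∑ j ∈ Uᶜ, (Splus S u j).card) + 1 := by
  have e : (U.map Fin.castSuccEmb)ᶜ = insert (Fin.last n) (Uᶜ.map Fin.castSuccEmb) := by
    ext v
    induction v using Fin.lastCases with
    | last => simp
    | cast v => simp
  rw [e, Finset.sum_insert (by simp), Finset.sum_map, add_comm]
  simp [DS]

theorem mem_Park_iff {S : Fin n → Fin n → Finset ℤ} {p : Fin n → ℕ} :
    p ∈ Park S ↔ ∀ U : Finset (Fin n), U.Nonempty →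
      ∃ u ∈ U, p u ≤ ∑ j ∈ Uᶜ, (Splus S u j).card := by
  simp only [Park, IsParking, Set.mem_ofPred_eq, sum_DS_eq, Nat.lt_succ_iff]

theorem gps_mem_Park {S : Fin n → Fin n → Finset ℤ} {R : Set (Fin n → ℝ)}
    (hR : R ∈ regions (braidArr S)) : gps S R ∈ Park S := by
  obtain ⟨x, hx, rfl⟩ := exists_eq_sameSide hR
  rw [mem_Park_iff]
  intro U hU
  obtain ⟨u, hu, hmin⟩ := U.exists_min_image x hU
  refine ⟨u, hu, ?_⟩
  rw [gps_sameSide hx, ← Finset.card_sigma]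
  -- A crossed letter `α_j^s` has `x_j ≤ x_j + s < x_u`, so `j ∉ U` by minimality of `x_u`.
  refine Finset.card_le_card_of_injOn (fun a => ⟨a.1, (a.2 : ℤ)⟩) ?_ ?_
  · rintro ⟨j, s⟩ h
    have h := mem_crossed.1 h
    simp only [Finset.mem_coe, Finset.mem_sigma, Finset.mem_compl]
    refine ⟨fun hj => ?_, h.1⟩
    have h1 := hmin j hj
    have h2 : (0 : ℝ) ≤ s := by positivity
    have h3 := h.2
    simp only at h3
    linarith
  · rintro ⟨j, s⟩ _ ⟨k, t⟩ _ h
    simpa using h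

end Regions

/-! ### The Shi and the Catalan arrangements -/

theorem isMEps_shiTuple (n k : ℕ) :
    IsMEps (shiTuple n k) (fun _ => k) (fun i j => if i < j then 0 else 1) := by
  refine ⟨fun i j _ => ?_, fun i j l _ _ hij => ?_, fun i j hij => ?_, fun i j hij => ?_⟩
  · dsimp only
    split_ifs <;> simp
  · dsimp only
    split_ifs with h1 h2
    · exact le_rfl
    · exact Nat.zero_le _
    · exact absurd (hij.trans ‹_›) h1
    · exact le_rfl
  · ext s
    simp only [Splus, shiTuple, hij, if_true, Finset.mem_filter, Finset.mem_Icc]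
    omega
  · ext s
    simp only [Splus, shiTuple, hij, hij.not_gt, if_true, if_false, Finset.mem_filter,
      Finset.mem_image, Finset.mem_Icc]
    constructor
    · rintro ⟨⟨a, ha, rfl⟩, h⟩
      omega
    · intro h
      exact ⟨⟨-s, by omega, by omega⟩, by omega⟩

theorem isMEps_catalanTuple (n k : ℕ) :
    IsMEps (catalanTuple n k) (fun _ => k) (fun _ _ => 0) := by
  refine ⟨fun i j _ => Or.inl rfl, fun i j l _ _ hij => le_rfl, fun i j hij => ?_,
    fun i j hij => ?_⟩
  · ext s
    simp only [Splus, catalanTuple, hij, if_true, Finset.mem_filter, Finset.mem_Icc]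
    omega
  · ext s
    simp only [Splus, catalanTuple, hij, hij.not_gt, if_true, if_false, Finset.mem_filter,
      Finset.mem_image, Finset.mem_Icc]
    constructor
    · rintro ⟨⟨a, ha, rfl⟩, h⟩
      omega
    · intro h
      exact ⟨⟨-s, by omega, by omega⟩, by omega⟩

/-! ### The region of a sketch -/

section BetaRegion

variable {n : ℕ}

theorem mem_Splus_catalanTuple {m : ℕ} {i j : Fin n} {s : ℤ} :
    s ∈ Splus (catalanTuple n m) i j ↔ (i < j ∧ 0 < s ∨ j < i ∧ 0 ≤ s) ∧ s ≤ m := by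
  have h := isMEps_catalanTuple n m
  rcases lt_trichotomy i j with hij | rfl | hij
  · rw [h.2.2.1 i j hij]
    simp [hij, hij.not_gt]
    omega
  · simp [Splus]
  · rw [h.2.2.2 i j hij]
    simp [hij, hij.not_gt]

theorem Splus_subset_catalanTuple {S : Fin n → Fin n → Finset ℤ} {i j : Fin n} {s : ℤ}
    (h : s ∈ Splus S i j) : s ∈ Splus (catalanTuple n (maxShift S)) i j :=
  mem_Splus_catalanTuple.2 ⟨((mem_Splus_iff S i j s).1 h).1, le_maxShift h⟩

theorem IsSketch.exists_mem_beta {m : ℕ} {w : List (Letter n)} (hw : IsSketch m w) :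
    ∃ x, x ∈ beta m w := by
  obtain ⟨x, hx⟩ := hw.exists_realization
  have hd := hw.nodup
  have hlt : ∀ (i j : Fin n) (s : ℕ), s ≤ m →
      (Before w (i, 0) (j, s) ∧ x i < x j + s) ∨
      (i = j ∧ s = 0) ∨ (¬ Before w (i, 0) (j, s) ∧ x j + s < x i) := by
    intro i j s hs
    by_cases h : Before w (i, 0) (j, s)
    · exact Or.inl ⟨h, by simpa using hx _ _ _ _ h⟩
    by_cases he : (i, 0) = (j, s)
    · obtain ⟨rfl, rfl⟩ := Prod.mk.inj he
      exact Or.inr (Or.inl ⟨rfl, rfl⟩)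
    · have h' := (not_before_comm hd ((hw.2.1 _ _).2 (Nat.zero_le _)) ((hw.2.1 _ _).2 hs) he).1 h
      exact Or.inr (Or.inr ⟨h, by simpa using hx _ _ _ _ h'⟩)
  refine ⟨x, mem_compl_braidArr_iff.2 fun i j s hs h => ?_, fun i j s hs => ?_⟩
  · have hij := ne_of_mem_Splus hs
    have hm := (mem_Splus_catalanTuple.1 hs).2
    lift s to ℕ using nonneg_of_mem_Splus hs
    push_cast at h
    rcases hlt i j s (by omega) with h' | h' | h'
    · linarith [h'.2]
    · exact hij h'.1
    · linarith [h'.2]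
  · rcases hlt i j s hs with h' | ⟨rfl, rfl⟩ | h'
    · exact iff_of_true (by linarith [h'.2]) h'.1
    · exact iff_of_false (by simp) (not_before_self hd _)
    · exact iff_of_false (by linarith [h'.2]) h'.1

theorem beta_eq_sameSide {m : ℕ} {w : List (Letter n)} {x : Fin n → ℝ} (hx : x ∈ beta m w) :
    beta m w = sameSide (catalanTuple n m) x := by
  have hgen := mem_compl_braidArr_iff.1 hx.1
  ext y
  refine and_congr_right fun hy => ?_
  have hy' := mem_compl_braidArr_iff.1 hy
  constructor
  · intro h i j s hs
    have h1 := hgen i j s hs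
    have h2 := hy' i j s hs
    have hm := (mem_Splus_catalanTuple.1 hs).2
    lift s to ℕ using nonneg_of_mem_Splus hs
    push_cast at *
    have h3 := (h i j s (by omega)).trans (hx.2 i j s (by omega)).symm
    rw [lt_iff_not_ge, lt_iff_not_ge, not_iff_not, le_iff_lt_or_eq, le_iff_lt_or_eq, h3]
    tauto
  · intro h i j s hs
    rw [← hx.2 i j s hs]
    by_cases hij : i = j
    · subst hij
      simp
    -- Here `0 ∉ S⁺_{i,j}`; the hyperplane is listed as `0 ∈ S⁺_{j,i}`, and the inequality is
    -- reversed.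
    by_cases hz : i < j ∧ s = 0
    · obtain ⟨hlt, rfl⟩ := hz
      have := h j i 0 (mem_Splus_catalanTuple.2 ⟨Or.inr ⟨hlt, le_rfl⟩, by positivity⟩)
      push_cast at *
      rw [sub_neg, sub_neg, ← sub_pos, this, sub_pos]
    · have hs' : (s : ℤ) ∈ Splus (catalanTuple n m) i j := by
        rw [mem_Splus_catalanTuple]
        omega
      have h1 := hgen i j s hs'
      have h2 := hy' i j s hs'
      have h3 := h i j s hs'
      push_cast at *
      rw [lt_iff_not_ge, lt_iff_not_ge, not_iff_not, le_iff_lt_or_eq, le_iff_lt_or_eq, h3]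
      tauto

theorem IsSketch.beta_mem_regions {m : ℕ} {w : List (Letter n)} (hw : IsSketch m w) :
    beta m w ∈ regions (braidArr (catalanTuple n m)) := by
  obtain ⟨x, hx⟩ := hw.exists_mem_beta
  rw [beta_eq_sameSide hx]
  exact sameSide_mem_regions hx.1

/-- The arrangement is contained in the Catalan arrangement of its largest shift, so the word
decides every side. -/
theorem IsSketch.betaS_eq {S : Fin n → Fin n → Finset ℤ} {w : List (Letter n)}
    (hw : IsSketch (maxShift S) w) :
    ∃ x ∈ compl (braidArr S), betaS S w = sameSide S x ∧
      ∀ (i j : Fin n) (s : ℕ), (s : ℤ) ∈ Splus S i j →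
        (x j + s < x i ↔ (j, s) ∈ upTo i w) := by
  obtain ⟨x, hx⟩ := hw.exists_mem_beta
  have hcompl : compl (braidArr (catalanTuple n (maxShift S))) ⊆ compl (braidArr S) :=
    fun y hy => mem_compl_braidArr_iff.2 fun i j s hs =>
      mem_compl_braidArr_iff.1 hy i j s (Splus_subset_catalanTuple hs)
  refine ⟨x, hcompl hx.1, ?_, fun i j s hs => ?_⟩
  · refine regionContaining_eq ⟨x, hx⟩ (sameSide_mem_regions (hcompl hx.1)) ?_
    rw [beta_eq_sameSide hx]
    exact fun y hy =>
      ⟨hcompl hy.1, fun i j s hs => hy.2 i j s (Splus_subset_catalanTuple hs)⟩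
  · have hm : s ≤ maxShift S := by exact_mod_cast le_maxShift hs
    have hij := ne_of_mem_Splus hs
    have h1 := mem_compl_braidArr_iff.1 (hcompl hx.1) i j s hs
    rw [mem_upTo_iff_before hw.nodup ((hw.2.1 _ _).2 (Nat.zero_le _)),
      ← not_before_comm hw.nodup ((hw.2.1 _ _).2 (Nat.zero_le _)) ((hw.2.1 _ _).2 hm)
        (by simp [hij]), ← hx.2 i j s hm, not_lt, le_iff_lt_or_eq]
    push_cast at h1
    constructor
    · intro h
      left
      linarith
    · rintro (h | h)
      · linarith
      · exact absurd h.symm h1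

end BetaRegion

/-! ### The process that writes the word -/

section Run

variable {n : ℕ}

/-- The letter written next has index `k`, and the list `O` of the state becomes `O'` before
the update. -/
inductive IsNext (P : Fin n → ℤ) : List (Fin n) → Fin n → List (Fin n) → Prop
  | zero {O : List (Fin n)} {k : Fin n} (hk : P k = 0) (hmax : ∀ i, P i = 0 → i ≤ k) :
      IsNext P O k O
  | queue {k : Fin n} {O' : List (Fin n)} (h : ∀ i, P i ≠ 0) : IsNext P (k :: O') k O'

/-- Both writing rules have the same form, because the exponent is `-P k` in the first one too. -/
theorem psiRun_invariant (S : Fin n → Fin n → Finset ℤ) (m : ℕ)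
    (C : List (Letter n) → (Fin n → ℤ) → List (Fin n) → Prop)
    (hC : ∀ w P O k O', C w P O → IsNext P O k O' →
      C (w ++ [(k, (-P k).toNat)]) (advance S P k (-P k)) (enqueue m O' k (-P k)))
    (P : Fin n → ℤ) (O : List (Fin n)) (w : List (Letter n)) (h : C w P O) :
    ∃ P', (∀ i, P' i ≠ 0) ∧ C (w ++ psiRun S m P O) P' [] := by
  induction P, O using psiRun.induct S m generalizing w with
  | case1 P O hz ih =>
    have hk : P ((zeros P).max' hz) = 0 := by
      have := (zeros P).max'_mem hz
      simpa [zeros] using this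
    have h1 := hC w P O _ O h (.zero hk fun i hi =>
      (zeros P).le_max' i (by simpa [zeros] using hi))
    rw [hk] at h1
    obtain ⟨P', h2, h3⟩ := ih _ h1
    refine ⟨P', h2, ?_⟩
    rw [psiRun.eq_def, dif_pos hz]
    simpa using h3
  | case2 P hz =>
    refine ⟨P, fun i hi => hz ⟨i, by simpa [zeros] using hi⟩, ?_⟩
    rw [psiRun, dif_neg hz]
    simpa using h
  | case3 P hz k O' ih =>
    have h1 := hC w P _ k O' h (.queue fun i hi => hz ⟨i, by simpa [zeros] using hi⟩)
    obtain ⟨P', h2, h3⟩ := ih _ h1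
    refine ⟨P', h2, ?_⟩
    rw [psiRun, dif_neg hz]
    simpa using h3

/-- The letters that the list `O` stands for. -/
def pending (P : Fin n → ℤ) (O : List (Fin n)) : List (Letter n) :=
  O.map fun k => (k, (-P k).toNat)

/-- The number of letters `α_j^s` with `s ∈ S⁺_{i,j}` before `α_i^0` in the word `w`. -/
def countUpTo (S : Fin n → Fin n → Finset ℤ) (i : Fin n) (w : List (Letter n)) : ℕ :=
  (upTo i w).countP fun a => (a.2 : ℤ) ∈ Splus S i a.1

/-- The invariants of the process started with the tuple `p`; `w` is the word written so far. -/
structure RunInv (S : Fin n → Fin n → Finset ℤ) (m : ℕ) (p : Fin n → ℕ)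
    (w : List (Letter n)) (P : Fin n → ℤ) (O : List (Fin n)) : Prop where
  mem : ∀ k (s : ℕ), (k, s) ∈ w ↔ (s : ℤ) < -P k
  bound : ∀ k, -P k ≤ m + 1
  mem_list : ∀ k, k ∈ O ↔ P k < 0 ∧ -P k ≤ m
  nodup_list : O.Nodup
  pairwise : w.Pairwise fun a b => a.1 = b.1 → a.2 < b.2
  queue : w.filter (fun a => 0 < a.2) ++ pending P O =
    (w.filter fun a => a.2 < m).map fun a => (a.1, a.2 + 1)
  count : ∀ i, countUpTo S i w + (P i).toNat = p i

variable {S : Fin n → Fin n → Finset ℤ} {m : ℕ} {p : Fin n → ℕ} {w : List (Letter n)}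
  {P : Fin n → ℤ} {O O' : List (Fin n)} {k : Fin n}

theorem advance_self : advance S P k (-P k) k = P k - 1 := by simp [advance]

theorem advance_of_nonpos {i : Fin n} (hik : i ≠ k) (hi : P i ≤ 0) (s : ℤ) :
    advance S P k s i = P i := by
  simp [advance, hik, hi]

theorem advance_of_pos {i : Fin n} (hik : i ≠ k) (hi : 0 < P i) (s : ℤ) :
    advance S P k s i = if s ∈ Splus S i k then P i - 1 else P i := by
  simp [advance, hik, hi]

theorem advance_nonneg {i : Fin n} (hik : i ≠ k) (hi : 0 < P i) (s : ℤ) :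
    0 ≤ advance S P k s i := by
  rw [advance_of_pos hik hi]
  split_ifs <;> omega

theorem RunInv.nodup (h : RunInv S m p w P O) : w.Nodup :=
  h.pairwise.imp fun hab he => by
    subst he
    exact lt_irrefl _ (hab rfl)

theorem RunInv.next_le (h : RunInv S m p w P O) (hn : IsNext P O k O') :
    0 ≤ -P k ∧ -P k ≤ m := by
  cases hn with
  | zero hk hmax => omega
  | queue h0 =>
    have := (h.mem_list k).1 (by simp)
    omega

theorem RunInv.notMem_next (h : RunInv S m p w P O) (hn : IsNext P O k O') : k ∉ O' := by
  cases hn with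
  | zero hk hmax =>
    rw [h.mem_list]
    omega
  | queue h0 => exact (List.nodup_cons.1 h.nodup_list).1

theorem RunInv.mem_next_iff (h : RunInv S m p w P O) (hn : IsNext P O k O') {i : Fin n}
    (hik : i ≠ k) : i ∈ O' ↔ P i < 0 ∧ -P i ≤ m := by
  rw [← h.mem_list]
  cases hn with
  | zero hk hmax => rfl
  | queue h0 => simp [hik]

theorem pending_advance (hk : k ∉ O') (hO : ∀ i ∈ O', P i < 0) (s : ℤ) :
    pending (advance S P k s) O' = pending P O' := by
  refine List.map_congr_left fun i hi => ?_
  have hik : i ≠ k := by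
    rintro rfl
    exact hk hi
  rw [advance_of_nonpos hik (hO i hi).le]

theorem RunInv.step (h : RunInv S m p w P O) (hn : IsNext P O k O') :
    RunInv S m p (w ++ [(k, (-P k).toNat)]) (advance S P k (-P k))
      (enqueue m O' k (-P k)) := by
  have hk := h.next_le hn
  have hkO := h.notMem_next hn
  have hmO : ∀ i, i ≠ k → (i ∈ O' ↔ P i < 0 ∧ -P i ≤ m) := fun i hi => h.mem_next_iff hn hi
  have hneg : ∀ i ∈ O', P i < 0 := fun i hi =>
    ((hmO i (by rintro rfl; exact hkO hi)).1 hi).1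
  refine ⟨fun i s => ?_, fun i => ?_, fun i => ?_, ?_, ?_, ?_, fun i => ?_⟩
  · rw [List.mem_append, h.mem, List.mem_singleton, Prod.mk.injEq]
    by_cases hik : i = k
    · subst hik
      rw [advance_self]
      simp only [true_and]
      omega
    · simp only [hik, false_and, or_false]
      rcases le_or_gt (P i) 0 with hi | hi
      · rw [advance_of_nonpos hik hi]
      · have := advance_nonneg (S := S) hik hi (-P k)
        omega
  · by_cases hik : i = k
    · subst hik
      rw [advance_self]
      omega
    · rcases le_or_gt (P i) 0 with hi | hi
      · rw [advance_of_nonpos hik hi]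
        exact h.bound i
      · have := advance_nonneg (S := S) hik hi (-P k)
        omega
  · by_cases hik : i = k
    · subst hik
      rw [advance_self]
      unfold enqueue
      split_ifs with hs
      · simp only [List.mem_append, hkO, List.mem_singleton, or_true, true_iff]
        omega
      · simp only [hkO, false_iff]
        omega
    · have e : i ∈ enqueue m O' k (-P k) ↔ i ∈ O' := by
        unfold enqueue
        split_ifs <;> simp [hik]
      rw [e, hmO i hik]
      rcases le_or_gt (P i) 0 with hi | hi
      · rw [advance_of_nonpos hik hi]
      · have := advance_nonneg (S := S) hik hi (-P k)
        omega
  · have hO' : O'.Nodup := by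
      cases hn with
      | zero hk hmax => exact h.nodup_list
      | queue h0 => exact (List.nodup_cons.1 h.nodup_list).2
    unfold enqueue
    split_ifs
    · exact List.nodup_append.2 ⟨hO', List.nodup_singleton _, by
        rintro a ha b hb rfl
        exact hkO (by simpa using List.mem_singleton.1 hb ▸ ha)⟩
    · exact hO'
  · rw [List.pairwise_append]
    refine ⟨h.pairwise, List.pairwise_singleton _ _, ?_⟩
    rintro ⟨i, s⟩ ha b hb he
    rw [List.mem_singleton] at hb
    subst hb
    dsimp only at he
    subst he
    have := (h.mem i s).1 ha
    dsimp only
    omega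
  -- The new letter moves from the front of the queue to the word (or has exponent `0` and is
  -- filtered out). Both sides gain `α_k^{s+1}` at the end exactly when `s < m`.
  · have e1 : pending (advance S P k (-P k)) (enqueue m O' k (-P k)) =
        pending P O' ++ if -P k < m then [(k, (-P k).toNat + 1)] else [] := by
      unfold enqueue
      split_ifs with hs
      · rw [← pending_advance (S := S) hkO hneg (-P k)]
        simp only [pending, List.map_append, List.map_cons, List.map_nil, advance_self]
        congr 3
        omega
      · rw [pending_advance hkO hneg, List.append_nil]
    have e2 : (List.filter (fun a => a.2 < m) [(k, (-P k).toNat)]).map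
        (fun a => (a.1, a.2 + 1)) = if -P k < m then [(k, (-P k).toNat + 1)] else [] := by
      have : (-P k).toNat < m ↔ -P k < m := by omega
      by_cases hs : -P k < m <;> simp [this, hs]
    have e3 : List.filter (fun a => decide (0 < a.2)) [(k, (-P k).toNat)] ++ pending P O' =
        pending P O := by
      cases hn with
      | zero hk hmax => simp [hk]
      | queue h0 =>
        have := (h.mem_list k).1 (by simp)
        have : 0 < (-P k).toNat := by omega
        simp [pending, this]
    rw [List.filter_append, List.filter_append, List.map_append, e1, e2, ← h.queue, ← e3]
    simp only [List.append_assoc]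
  · rw [← h.count i]
    -- Once `α_i^0` is written, `P_i < 0`, and neither the count nor the positive part changes.
    by_cases hi : (i, 0) ∈ w
    · have hi' := (h.mem i 0).1 hi
      have : (advance S P k (-P k) i).toNat = (P i).toNat := by
        have := advance_le S P k (-P k) i
        push_cast at hi'
        omega
      rw [countUpTo, upTo_append_of_mem hi, this, countUpTo]
    have hi' := mt (h.mem i 0).2 hi
    push_cast at hi'
    by_cases hik : i = k
    · subst hik
      have hs : P i = 0 := by omega
      have : (-P i).toNat = 0 := by omega
      rw [this, countUpTo, upTo_append_self hi, countUpTo, upTo_of_notMem hi, advance_self, hs]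
      simp
    · rw [countUpTo, upTo_append_singleton_of_notMem hi hik, countUpTo, upTo_of_notMem hi,
        List.countP_append, List.countP_singleton]
      have hcast : (((-P k).toNat : ℕ) : ℤ) = -P k := Int.toNat_of_nonneg hk.1
      simp only [hcast, decide_eq_true_eq]
      rcases (show 0 ≤ P i by omega).lt_or_eq with h0 | h0
      · rw [advance_of_pos hik h0]
        split_ifs <;> omega
      -- A zero entry is not lowered, so the new letter must not count for `α_i^0`. This is why
      -- zeros come first and the rightmost is taken: then `i < k`, and `0 ∉ S⁺_{i,k}`.
      · rw [advance_of_nonpos hik h0.symm.le, if_neg, add_zero]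
        intro hs
        cases hn with
        | zero hk hmax =>
          have := pos_of_mem_Splus hs (lt_of_le_of_ne (hmax i h0.symm) hik)
          omega
        | queue hq => exact hq i h0.symm

theorem runInv_init (S : Fin n → Fin n → Finset ℤ) (m : ℕ) (p : Fin n → ℕ) :
    RunInv S m p [] (fun i => (p i : ℤ)) [] := by
  refine ⟨fun k s => ?_, fun k => ?_, fun k => ?_, List.nodup_nil, List.Pairwise.nil, rfl,
    fun i => ?_⟩
  · simp only [List.not_mem_nil, false_iff]
    omega
  · omega
  · simp only [List.not_mem_nil, false_iff]
    omega
  · simp [countUpTo, upTo]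

theorem RunInv.countUpTo_eq_card (h : RunInv S m p w P O) (i : Fin n) :
    countUpTo S i w =
      ((upTo i w).toFinset.filter fun a => (a.2 : ℤ) ∈ Splus S i a.1).card := by
  have hd : (upTo i w).Nodup := h.nodup.sublist (List.takeWhile_sublist _)
  rw [countUpTo, List.countP_eq_length_filter, ← List.toFinset_card_of_nodup (hd.filter _),
    List.toFinset_filter]
  simp

/-- Successors leave the queue in the order in which they entered it. -/
theorem RunInv.before_succ (h : RunInv S m p w P O) {i j : Fin n} {s t : ℕ} (hs : s < m)
    (ht : t < m) (hb : Before w (i, s) (j, t)) :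
    List.Sublist [(i, s + 1), (j, t + 1)] (w.filter (fun a => 0 < a.2) ++ pending P O) := by
  rw [h.queue]
  rw [before_iff_sublist] at hb
  have := (hb.filter fun a => decide (a.2 < m)).map fun a => (a.1, a.2 + 1)
  simpa [hs, ht] using this

/-- A run that stops has written all letters if it was started with a parking function. -/
theorem RunInv.isSketch (h : RunInv S (maxShift S) p w P []) (hP : ∀ i, P i ≠ 0)
    (hp : p ∈ Park S) : IsSketch (maxShift S) w := by
  have hneg : ∀ i, P i < 0 → P i = -(maxShift S + 1) := by
    intro i hi
    have h1 := mt (h.mem_list i).2 (by simp)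
    have h2 := h.bound i
    omega
  have hall : ∀ i, P i = -(maxShift S + 1) := by
    by_contra hc
    push Not at hc
    obtain ⟨i, hi⟩ := hc
    -- Let `U` consist of the indices with `P_i > 0`. Outside `U` all letters are written, so the
    -- count for `u` has already reached the parking bound for `p_u`, against `P_u > 0`.
    obtain ⟨u, hu, hpu⟩ := mem_Park_iff.1 hp (Finset.univ.filter fun i => 0 < P i) ⟨i, by
      have := hneg i
      have := hP i
      simp only [Finset.mem_filter, Finset.mem_univ, true_and]
      omega⟩
    simp only [Finset.mem_filter, Finset.mem_univ, true_and] at hu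
    have hcount := h.count u
    have hu0 : (u, 0) ∉ w := by
      rw [h.mem]
      push_cast
      omega
    rw [h.countUpTo_eq_card, upTo_of_notMem hu0] at hcount
    have hle : ∑ j ∈ (Finset.univ.filter fun i => 0 < P i)ᶜ, (Splus S u j).card ≤
        (w.toFinset.filter fun a => (a.2 : ℤ) ∈ Splus S u a.1).card := by
      rw [← Finset.card_sigma]
      refine Finset.card_le_card_of_injOn (fun a => (a.1, a.2.toNat)) ?_ ?_
      · rintro ⟨j, s⟩ hs
        simp only [Finset.mem_coe, Finset.mem_sigma, Finset.mem_compl, Finset.mem_filter,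
          Finset.mem_univ, true_and] at hs
        obtain ⟨hj, hs⟩ := hs
        have h0 := nonneg_of_mem_Splus hs
        have hm := le_maxShift hs
        have := hneg j (by have := hP j; omega)
        simp only [Finset.coe_filter, List.mem_toFinset, Set.mem_ofPred_eq, h.mem]
        rw [Int.toNat_of_nonneg h0]
        exact ⟨by omega, hs⟩
      · rintro ⟨j, s⟩ hs ⟨l, t⟩ ht he
        simp only [Finset.mem_coe, Finset.mem_sigma] at hs ht
        have h0 := nonneg_of_mem_Splus hs.2
        have h1 := nonneg_of_mem_Splus ht.2
        obtain ⟨rfl, he⟩ := Prod.mk.inj he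
        have : s = t := by
          dsimp only at h0 h1 he
          omega
        subst this
        rfl
    omega
  have hmem : ∀ i s, (i, s) ∈ w ↔ s ≤ maxShift S := by
    intro i s
    rw [h.mem, hall i]
    omega
  refine ⟨?_, hmem, fun i s hs => ?_, fun i j s t hs ht hb => ?_⟩
  · have e : w.toFinset = Finset.univ ×ˢ Finset.range (maxShift S + 1) := by
      ext ⟨i, s⟩
      simp [hmem]
    rw [← List.toFinset_card_of_nodup h.nodup, e]
    simp [mul_comm]
  · rw [← not_before_comm h.nodup ((hmem _ _).2 hs) ((hmem _ _).2 hs.le) (by simp),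
      before_iff_sublist]
    intro hb
    have := h.pairwise.sublist hb
    simp at this
  · have := h.before_succ hs ht hb
    rw [before_iff_sublist]
    simp only [pending, List.map_nil, List.append_nil] at this
    exact this.trans List.filter_sublist

theorem Psi_runInv (S : Fin n → Fin n → Finset ℤ) (p : Fin n → ℕ) :
    ∃ P, (∀ i, P i ≠ 0) ∧ RunInv S (maxShift S) p (Psi S p) P [] := by
  have := psiRun_invariant S (maxShift S) (RunInv S (maxShift S) p)
    (fun w P O k O' h hn => h.step hn) _ [] [] (runInv_init S _ p)
  simpa [Psi] using this

theorem isSketch_Psi {S : Fin n → Fin n → Finset ℤ} {p : Fin n → ℕ} (hp : p ∈ Park S) :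
    IsSketch (maxShift S) (Psi S p) := by
  obtain ⟨P, hP, h⟩ := Psi_runInv S p
  exact h.isSketch hP hp

theorem gps_betaS_Psi {S : Fin n → Fin n → Finset ℤ} {p : Fin n → ℕ} (hp : p ∈ Park S) :
    gps S (betaS S (Psi S p)) = p := by
  obtain ⟨P, hP, h⟩ := Psi_runInv S p
  have hw := h.isSketch hP hp
  obtain ⟨x, hx, he, hiff⟩ := hw.betaS_eq
  funext i
  have hcount := h.count i
  have hneg : P i < 0 := by
    have := (h.mem i 0).1 ((hw.2.1 i 0).2 (Nat.zero_le _))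
    push_cast at this
    omega
  rw [Int.toNat_of_nonpos hneg.le, add_zero, h.countUpTo_eq_card] at hcount
  rw [he, gps_sameSide hx, ← hcount]
  congr 1
  ext ⟨j, s⟩
  simp only [mem_crossed, Finset.mem_filter, List.mem_toFinset]
  rw [and_comm]
  exact and_congr_left fun hs => hiff i j s hs

end Run

/-! ### Injectivity of the labeling -/

section Injectivity

variable {n : ℕ} {S : Fin n → Fin n → Finset ℤ} {p : Fin n → ℕ} {w : List (Letter n)}
  {P : Fin n → ℤ} {O O' : List (Fin n)} {k : Fin n} {x : Fin n → ℝ}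

/-- The word `w` agrees with the point `x` on the hyperplanes of the arrangement as far as it
decides on which side of them a point lies. -/
def Agrees (S : Fin n → Fin n → Finset ℤ) (x : Fin n → ℝ) (w : List (Letter n)) : Prop :=
  ∀ (i j : Fin n) (s : ℕ), (s : ℤ) ∈ Splus S i j →
    ((j, s) ∈ upTo i w → x j + s < x i) ∧
    ((i, 0) ∈ w → (j, s) ∉ upTo i w → x i < x j + s)

theorem Agrees.filter_subset (ha : Agrees S x w) (i : Fin n) :
    ((upTo i w).toFinset.filter fun a => (a.2 : ℤ) ∈ Splus S i a.1) ⊆ crossed S x i := by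
  rintro ⟨j, s⟩ h
  simp only [Finset.mem_filter, List.mem_toFinset] at h
  exact mem_crossed.2 ⟨h.2, (ha i j s h.2).1 h.1⟩

/-- If `P_i = 0`, then all letters that must precede `α_i^0` are written. -/
theorem RunInv.mem_of_crossed (h : RunInv S (maxShift S) p w P O) (ha : Agrees S x w)
    (hp : ∀ i, p i = (crossed S x i).card) {i : Fin n} (hi : P i = 0) {a : Letter n}
    (hx : a ∈ crossed S x i) : a ∈ w := by
  have hcount := h.count i
  rw [hi, h.countUpTo_eq_card, hp] at hcount
  -- The counted letters are crossed, and there are `p_i` of them, so they are all the crossed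
  -- letters.
  rw [← Finset.eq_of_subset_of_card_le (ha.filter_subset i) (by simp [← hcount])] at hx
  simp only [Finset.mem_filter, List.mem_toFinset] at hx
  exact mem_of_mem_upTo hx.1

/-- If `P_i > 0`, then some letter that must precede `α_i^0` is not yet written. -/
theorem RunInv.exists_notMem_of_crossed (h : RunInv S (maxShift S) p w P O)
    (hp : ∀ i, p i = (crossed S x i).card) {i : Fin n} (hi : 0 < P i) :
    ∃ a ∈ crossed S x i, a ∉ w := by
  by_contra! hc
  have hcount := h.count i
  have hi0 : (i, 0) ∉ w := by
    rw [h.mem]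
    push_cast
    omega
  rw [h.countUpTo_eq_card, hp, upTo_of_notMem hi0] at hcount
  have : crossed S x i ⊆ w.toFinset.filter fun a => (a.2 : ℤ) ∈ Splus S i a.1 := fun a hx =>
    Finset.mem_filter.2 ⟨List.mem_toFinset.2 (hc a hx), (mem_crossed.1 hx).1⟩
  have := Finset.card_le_card this
  omega

/-- If the letter at the front of the list is `α_k^s` and `α_j^t` is not yet written, then
`α_j^{t-u}` is not before `α_k^{s-u}`. -/
theorem RunInv.not_before_of_queue {m : ℕ} (h : RunInv S m p w P (k :: O')) {j : Fin n}
    (u : ℕ) {s t : ℕ} (hs : ((s + u : ℕ) : ℤ) = -P k) (ht : t + u ≤ m) (hu : 0 < u)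
    (hjw : (j, t + u) ∉ w) : ¬ Before w (j, t) (k, s) := by
  have hk := (h.mem_list k).1 (by simp)
  have hjk : w.filter (fun a => 0 < a.2) ++ pending P (k :: O') =
      w.filter (fun a => 0 < a.2) ++ (k, (-P k).toNat) :: pending P O' := rfl
  have hkO : (k, (-P k).toNat) ∉ pending P O' := by
    intro hc
    obtain ⟨l, hl, he⟩ := List.mem_map.1 hc
    obtain ⟨rfl, -⟩ := Prod.mk.inj he
    exact (List.nodup_cons.1 h.nodup_list).1 hl
  obtain ⟨v, rfl⟩ : ∃ v, u = v + 1 := ⟨u - 1, by omega⟩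
  clear hu
  induction v generalizing s t with
  | zero =>
    intro hb
    have h1 := h.before_succ (by omega) (by omega) hb
    have e : s + 1 = (-P k).toNat := by omega
    rw [hjk, List.sublist_append_iff] at h1
    -- Base case: `α_k^{s+1}` heads the queue, so a letter before it is already written.
    obtain ⟨l₁, l₂, he, h2, h3⟩ := h1
    rcases l₁ with _ | ⟨c, l₁⟩
    · rw [List.nil_append] at he
      rw [← he, e] at h3
      generalize (-P k).toNat = r at h3 hkO
      cases h3 with
      | cons _ h3 => exact hkO (h3.subset (by simp))
      | cons_cons _ h3 => exact hkO (h3.subset (by simp))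
    · rw [List.cons_append, List.cons.injEq] at he
      rw [← he.1] at h2
      exact hjw (List.mem_of_mem_filter (h2.subset (by simp)))
  | succ v ih =>
    intro hb
    have h1 := h.before_succ (by omega) (by omega) hb
    refine ih (s := s + 1) (t := t + 1) (by push_cast at *; omega) (by omega)
      (by rwa [show t + 1 + (v + 1) = t + (v + 1 + 1) by omega]) ?_
    rw [before_iff_sublist]
    rw [List.sublist_append_iff] at h1
    obtain ⟨l₁, l₂, he, h2, h3⟩ := h1
    -- The only pending letter of index `k` has a larger exponent. So `α_k^{s+1}` is written, hence
    -- also any letter before it, and both exponents can be raised.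
    have hkp : (k, s + 1) ∉ pending P (k :: O') := by
      intro hc
      obtain ⟨l, hl, he⟩ := List.mem_map.1 hc
      obtain ⟨rfl, he⟩ := Prod.mk.inj he
      push_cast at hs
      omega
    have hl₂ : l₂ = [] := by
      by_contra hne
      have hlast : l₂.getLast hne = (k, s + 1) := by
        have : (l₁ ++ l₂).getLast (by simp [hne]) = (k, s + 1) := by
          simp [← he]
        rwa [List.getLast_append_of_ne_nil _ hne] at this
      exact hkp (h3.subset (hlast ▸ List.getLast_mem hne))
    rw [hl₂, List.append_nil] at he
    rw [he]
    exact h2.trans List.filter_sublist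

/-- When `α_k^0` is written, it is before all later `α_i^0` on the right side of the
hyperplane `x_i = x_k`. -/
theorem lt_of_next_zero {m : Fin n → ℕ} {ε : Fin n → Fin n → ℕ} (hS : IsMEps S m ε)
    (h : RunInv S (maxShift S) p w P O) (ha : Agrees S x w)
    (hp : ∀ i, p i = (crossed S x i).card) (hgen : x ∈ compl (braidArr S))
    (hk : P k = 0) (hmax : ∀ i, P i = 0 → i ≤ k) (i : Fin n) (hki : k < i)
    (hiw : (i, 0) ∉ w) (hs : 0 ∈ Splus S i k) : x k < x i := by
  induction i using WellFoundedLT.induction with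
  | ind i ih =>
    by_contra hlt
    have hne : x i - x k ≠ 0 := by
      simpa using mem_compl_braidArr_iff.1 hgen i k 0 hs
    have hlt : x i < x k := lt_of_le_of_ne (not_lt.1 hlt) fun e => hne (by linarith)
    have hPi : 0 < P i := by
      have h1 := mt (h.mem i 0).2 hiw
      have h2 : P i ≠ 0 := fun e => (hmax i e).not_gt hki
      push_cast at h1
      omega
    obtain ⟨⟨j, t⟩, hc, hjw⟩ := h.exists_notMem_of_crossed hp hPi
    obtain ⟨hjS, hjx⟩ := mem_crossed.1 hc
    dsimp only at hjS hjx
    have ht0 : (0 : ℝ) ≤ t := by positivity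
    have hij := ne_of_mem_Splus hjS
    have hjk : j ≠ k := by
      rintro rfl
      linarith
    have hnot : (t : ℤ) ∉ Splus S k j := fun hc' =>
      -- As `P_k = 0`, all letters crossed by `x` for `k` are written, but `α_j^t` is not.
      hjw (h.mem_of_crossed ha hp hk (mem_crossed.2 ⟨hc', by dsimp only; linarith⟩))
    have hε := hS.2.1 k i j hjk.symm hij hki
    -- Since `ε_{k,j} ≤ ε_{i,j}`, the upper end of `S⁺_{k,j}` is no smaller than that of `S⁺_{i,j}`.
    -- Only the lower end can exclude `t`.
    have hji : j < i ∧ k < j ∧ t = 0 := by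
      rcases lt_or_gt_of_ne hij with h1 | h1 <;> rcases lt_or_gt_of_ne hjk with h2 | h2
      · exact absurd h1 (h2.trans hki).asymm
      · rw [hS.2.2.1 i j h1, Finset.mem_Icc] at hjS
        rw [hS.2.2.1 k j h2, Finset.mem_Icc] at hnot
        omega
      · rw [hS.2.2.2 i j h1, Finset.mem_Icc] at hjS
        rw [hS.2.2.2 k j h2, Finset.mem_Icc] at hnot
        omega
      · rw [hS.2.2.2 i j h1, Finset.mem_Icc] at hjS
        rw [hS.2.2.1 k j h2, Finset.mem_Icc] at hnot
        exact ⟨h1, h2, by omega⟩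
    obtain ⟨hji, hkj, rfl⟩ := hji
    have hε' := hS.2.1 j i k hjk hki.ne' hji
    have hjS' : 0 ∈ Splus S j k := by
      rw [hS.2.2.2 i k hki, Finset.mem_Icc] at hs
      rw [hS.2.2.2 j k hkj, Finset.mem_Icc]
      omega
    have := ih j hji hkj hjw hjS'
    linarith

/-- When `α_k^s` is taken from the list, it is before all later `α_i^0` on the right side of
the hyperplane `x_i - x_k = s`. -/
theorem lt_of_next_queue {m : Fin n → ℕ} {ε : Fin n → Fin n → ℕ} (hS : IsMEps S m ε)
    (h : RunInv S (maxShift S) p w P (k :: O')) (ha : Agrees S x w)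
    (hp : ∀ i, p i = (crossed S x i).card) (hgen : x ∈ compl (braidArr S))
    (hP : ∀ i, P i ≠ 0) {s : ℕ} (hsP : (s : ℤ) = -P k) (i : Fin n)
    (hiw : (i, 0) ∉ w) (hs : (s : ℤ) ∈ Splus S i k) : x k + s < x i := by
  have hkneg := (h.mem_list k).1 (by simp)
  induction i using WellFoundedLT.induction with
  | ind i ih =>
    by_contra hlt
    have hne : x i - x k ≠ s := by
      simpa using mem_compl_braidArr_iff.1 hgen i k s hs
    have hlt : x i < x k + s := lt_of_le_of_ne (not_lt.1 hlt) fun e => hne (by linarith)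
    have hPi : 0 < P i := by
      have h1 := mt (h.mem i 0).2 hiw
      have h2 := hP i
      push_cast at h1
      omega
    obtain ⟨⟨j, t⟩, hc, hjw⟩ := h.exists_notMem_of_crossed hp hPi
    obtain ⟨hjS, hjx⟩ := mem_crossed.1 hc
    dsimp only at hjS hjx
    have ht0 : (0 : ℝ) ≤ t := by positivity
    have hij := ne_of_mem_Splus hjS
    have hik := ne_of_mem_Splus hs
    have htm := le_maxShift hjS
    have hmk : ∀ l, l ≠ k → ε l k ≤ 1 := fun l hl => by
      rcases hS.1 l k hl with h' | h' <;> omega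
    have hmj : ∀ l, l ≠ j → ε l j ≤ 1 := fun l hl => by
      rcases hS.1 l j hl with h' | h' <;> omega
    have hsk : (s : ℤ) ≤ m k - ε i k := by
      rcases lt_or_gt_of_ne hik with h1 | h1
      · rw [hS.2.2.1 i k h1, Finset.mem_Icc] at hs
        exact hs.2
      · rw [hS.2.2.2 i k h1, Finset.mem_Icc] at hs
        exact hs.2
    have htj : (t : ℤ) ≤ m j - ε i j := by
      rcases lt_or_gt_of_ne hij with h1 | h1
      · rw [hS.2.2.1 i j h1, Finset.mem_Icc] at hjS
        exact hjS.2
      · rw [hS.2.2.2 i j h1, Finset.mem_Icc] at hjS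
        exact hjS.2
    -- Unwritten letters of index `k` have exponent at least `s`.
    have hjk : j ≠ k := by
      rintro rfl
      have h1 := mt (h.mem j t).2 hjw
      have : (s : ℝ) ≤ t := by
        have : s ≤ t := by omega
        exact_mod_cast this
      linarith
    rcases Nat.eq_zero_or_pos t with rfl | htpos
    -- For `t = 0` the index `j < i` would be a smaller failure: `ε_{j,k} ≤ ε_{i,k}` puts `s` in
    -- `S⁺_{j,k}`.
    · have hji : j < i := by
        by_contra hc'
        have := pos_of_mem_Splus hjS (lt_of_le_of_ne (not_lt.1 hc') hij)
        simp at this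
      have hε := hS.2.1 j i k hjk hik hji
      have hjS' : (s : ℤ) ∈ Splus S j k := by
        rcases lt_or_gt_of_ne hjk with h1 | h1
        · rw [hS.2.2.1 j k h1, Finset.mem_Icc]
          omega
        · rw [hS.2.2.2 j k h1, Finset.mem_Icc]
          omega
      have := ih j hji hjw hjS'
      push_cast at hjx
      linarith
    have hkw : ∀ r : ℕ, r < s → (k, r) ∈ w := fun r hr => (h.mem k r).2 (by omega)
    have hspos : 0 < s := by omega
    -- Lower both exponents by `min s t > 0`. This absorbs `ε ≤ 1`, so the upper bounds hold
    -- automatically.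
    rcases le_or_gt s t with hst | hst
    · have hb : ¬ Before w (j, t - s) (k, 0) :=
        h.not_before_of_queue s (by push_cast; omega) (by omega) hspos
          (by rwa [Nat.sub_add_cancel hst])
      have hcast : ((t - s : ℕ) : ℝ) = t - s := by push_cast [hst]; ring
      by_cases hr : ((t - s : ℕ) : ℤ) ∈ Splus S k j
      · have hnot : (j, t - s) ∉ upTo k w := by
          rwa [mem_upTo_iff_before h.nodup (hkw 0 hspos)]
        have := (ha k j (t - s) hr).2 (hkw 0 hspos) hnot
        rw [hcast] at this
        linarith
      -- The one difference lost is `0` with `k < j`; that hyperplane appears from the side of `j`,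
      -- as `0 ∈ S⁺_{j,k}`.
      · have hkj : k < j ∧ t = s := by
          have := hmj k hjk.symm
          rcases lt_or_gt_of_ne hjk with h1 | h1
          · rw [hS.2.2.2 k j h1, Finset.mem_Icc] at hr
            omega
          · rw [hS.2.2.1 k j h1, Finset.mem_Icc] at hr
            exact ⟨h1, by omega⟩
        obtain ⟨hkj, rfl⟩ := hkj
        rw [Nat.sub_self] at hb
        have hjS' : ((0 : ℕ) : ℤ) ∈ Splus S j k := by
          have := hmk j hjk
          rw [hS.2.2.2 j k hkj, Finset.mem_Icc]
          constructor <;> omega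
        have := (ha j k 0 hjS').1 ((mem_upTo_iff h.nodup).2
          ⟨hkw 0 hspos, by simp [hjk.symm], hb⟩)
        push_cast at this
        linarith
    · have hb : ¬ Before w (j, 0) (k, s - t) :=
        h.not_before_of_queue t (by push_cast [hst.le]; omega) (by omega) htpos (by simpa)
      have hcast : ((s - t : ℕ) : ℝ) = s - t := by push_cast [hst.le]; ring
      have hjS' : ((s - t : ℕ) : ℤ) ∈ Splus S j k := by
        have := hmk j hjk
        rcases lt_or_gt_of_ne hjk with h1 | h1
        · rw [hS.2.2.1 j k h1, Finset.mem_Icc]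
          omega
        · rw [hS.2.2.2 j k h1, Finset.mem_Icc]
          omega
      have := (ha j k (s - t) hjS').1 ((mem_upTo_iff h.nodup).2
        ⟨hkw (s - t) (by omega), by simp [hjk.symm], hb⟩)
      rw [hcast] at this
      linarith

theorem lt_of_next {m : Fin n → ℕ} {ε : Fin n → Fin n → ℕ} (hS : IsMEps S m ε)
    (h : RunInv S (maxShift S) p w P O) (ha : Agrees S x w)
    (hp : ∀ i, p i = (crossed S x i).card) (hgen : x ∈ compl (braidArr S))
    (hn : IsNext P O k O') {s : ℕ} (hsP : (s : ℤ) = -P k) {i : Fin n}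
    (hiw : (i, 0) ∉ w) (hs : (s : ℤ) ∈ Splus S i k) : x k + s < x i := by
  cases hn with
  | zero hk hmax =>
    have hs0 : s = 0 := by omega
    subst hs0
    have hki : k < i := by
      by_contra hc
      have := pos_of_mem_Splus hs (lt_of_le_of_ne (not_lt.1 hc) (ne_of_mem_Splus hs))
      simp at this
    simpa using lt_of_next_zero hS h ha hp hgen hk hmax i hki hiw hs
  | queue hP => exact lt_of_next_queue hS h ha hp hgen hP hsP i hiw hs

/-- Only sides belonging to unwritten `α_i^0` are affected. If the new letter is `α_i^0`, then `P_i
= 0` and all crossed letters are present; otherwise `lt_of_next` applies. -/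
theorem Agrees.step {m : Fin n → ℕ} {ε : Fin n → Fin n → ℕ} (hS : IsMEps S m ε)
    (h : RunInv S (maxShift S) p w P O) (ha : Agrees S x w)
    (hp : ∀ i, p i = (crossed S x i).card) (hgen : x ∈ compl (braidArr S))
    (hn : IsNext P O k O') : Agrees S x (w ++ [(k, (-P k).toNat)]) := by
  have hk := h.next_le hn
  intro i j s hs
  by_cases hi : (i, 0) ∈ w
  · rw [upTo_append_of_mem hi]
    exact ⟨(ha i j s hs).1, fun _ => (ha i j s hs).2 hi⟩
  have hold : (j, s) ∈ w → x j + s < x i := by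
    have := (ha i j s hs).1
    rwa [upTo_of_notMem hi] at this
  by_cases hik : i = k
  · subst hik
    have hPi : P i = 0 := by
      have := mt (h.mem i 0).2 hi
      push_cast at this
      omega
    rw [hPi, neg_zero, Int.toNat_zero, upTo_append_self hi]
    refine ⟨hold, fun _ hj => ?_⟩
    have hne := mem_compl_braidArr_iff.1 hgen i j s hs
    push_cast at hne
    refine lt_of_le_of_ne (not_lt.1 fun hlt => hj ?_) fun e => hne (by linarith)
    exact h.mem_of_crossed ha hp hPi (mem_crossed.2 ⟨hs, hlt⟩)
  · rw [upTo_append_singleton_of_notMem hi hik]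
    refine ⟨fun hj => ?_, fun hc => absurd hc (by simp [hi, hik])⟩
    rcases List.mem_append.1 hj with hj | hj
    · exact hold hj
    · rw [List.mem_singleton] at hj
      obtain ⟨rfl, rfl⟩ := Prod.mk.inj hj
      exact lt_of_next hS h ha hp hgen hn (Int.toNat_of_nonneg hk.1) hi hs

theorem agrees_Psi {m : Fin n → ℕ} {ε : Fin n → Fin n → ℕ} (hS : IsMEps S m ε)
    (hp : ∀ i, p i = (crossed S x i).card) (hgen : x ∈ compl (braidArr S)) :
    Agrees S x (Psi S p) := by
  obtain ⟨P, -, -, h⟩ := psiRun_invariant S (maxShift S)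
    (fun w P O => RunInv S (maxShift S) p w P O ∧ Agrees S x w)
    (fun w P O k O' h hn => ⟨h.1.step hn, h.2.step hS h.1 hp hgen hn⟩) _ [] []
    ⟨runInv_init S _ p, fun i j s _ => by simp [upTo]⟩
  exact h

theorem betaS_Psi_gps {m : Fin n → ℕ} {ε : Fin n → Fin n → ℕ} (hS : IsMEps S m ε)
    {R : Set (Fin n → ℝ)} (hR : R ∈ regions (braidArr S)) :
    betaS S (Psi S (gps S R)) = R := by
  have hpark := gps_mem_Park hR
  obtain ⟨x, hx, rfl⟩ := exists_eq_sameSide hR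
  have hw := isSketch_Psi hpark
  have hag := agrees_Psi hS (gps_sameSide hx) hx
  obtain ⟨y, hy, he, hiff⟩ := hw.betaS_eq
  rw [he]
  have key : ∀ i j, ∀ s ∈ Splus S i j, ((s : ℝ) < y i - y j ↔ (s : ℝ) < x i - x j) := by
    intro i j s hs
    lift s to ℕ using nonneg_of_mem_Splus hs
    have h1 := hiff i j s hs
    have h2 := hag i j s hs
    push_cast
    rw [lt_sub_iff_add_lt', lt_sub_iff_add_lt', h1]
    -- In the finished word every `α_i^0` occurs, so agreement decides both directions.
    refine ⟨h2.1, fun h => ?_⟩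
    by_contra hc
    exact h.asymm (h2.2 ((hw.2.1 _ _).2 (Nat.zero_le _)) hc)
  ext z
  refine and_congr_right fun _ => ?_
  constructor
  · exact fun h i j s hs => (h i j s hs).trans (key i j s hs)
  · exact fun h i j s hs => (h i j s hs).trans (key i j s hs).symm

end Injectivity

theorem betaS_Psi_mem_regions {n : ℕ} {S : Fin n → Fin n → Finset ℤ} {p : Fin n → ℕ}
    (hp : p ∈ Park S) : betaS S (Psi S p) ∈ regions (braidArr S) := by
  obtain ⟨x, hx, he, -⟩ := (isSketch_Psi hp).betaS_eq
  rw [he]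
  exact sameSide_mem_regions hx

end GPS

theorem theorem4p2 (n : ℕ) :
    (∀ (S : Fin n → Fin n → Finset ℤ) (m : Fin n → ℕ) (ε : Fin n → Fin n → ℕ),
      GPS.IsMEps S m ε →
        Set.BijOn (GPS.gps S) (GPS.regions (GPS.braidArr S)) (GPS.Park S) ∧
        (∀ p ∈ GPS.Park S,
          GPS.IsSketch (GPS.maxShift S) (GPS.Psi S p) ∧
          GPS.beta (GPS.maxShift S) (GPS.Psi S p) ∈
            GPS.regions (GPS.braidArr (GPS.catalanTuple n (GPS.maxShift S)))) ∧
        Set.MapsTo (GPS.betaS S ∘ GPS.Psi S) (GPS.Park S) (GPS.regions (GPS.braidArr S)) ∧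
        Set.InvOn (GPS.betaS S ∘ GPS.Psi S) (GPS.gps S)
          (GPS.regions (GPS.braidArr S)) (GPS.Park S)) ∧
    (∀ k : ℕ, GPS.IsMEps (GPS.shiTuple n k) (fun _ => k)
      (fun i j => if i < j then 0 else 1)) ∧
    (∀ k : ℕ, GPS.IsMEps (GPS.catalanTuple n k) (fun _ => k) (fun _ _ => 0)) := by
  refine ⟨fun S m ε hS => ?_, GPS.isMEps_shiTuple n, GPS.isMEps_catalanTuple n⟩
  have hmaps : Set.MapsTo (GPS.betaS S ∘ GPS.Psi S) (GPS.Park S)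
      (GPS.regions (GPS.braidArr S)) := fun p hp => GPS.betaS_Psi_mem_regions hp
  have hinv : Set.InvOn (GPS.betaS S ∘ GPS.Psi S) (GPS.gps S)
      (GPS.regions (GPS.braidArr S)) (GPS.Park S) :=
    ⟨fun R hR => GPS.betaS_Psi_gps hS hR, fun p hp => GPS.gps_betaS_Psi hp⟩
  exact ⟨hinv.bijOn (fun R hR => GPS.gps_mem_Park hR) hmaps,
    fun p hp => ⟨GPS.isSketch_Psi hp, (GPS.isSketch_Psi hp).beta_mem_regions⟩, hmaps, hinv⟩
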